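/- **Market.** A market $\mathcal M$ has finite sets $\mathcal A$ of agents, $\mathcal F$ of firms and $\mathcal G\neq\emptyset$ of goods, $n=|\mathcal G|$. Agent $i$ owns $w^i_j\ge 0$ of good $j$, with $\sum_i w^i_j=1$, and a share $\theta^i_f\ge 0$ of firm $f$, with $\sum_i\theta^i_f=1$. The utility of agent $i$ is $U^i(x)=\sum_j U^i_j(x_j)$. Firm $f$ produces one good $j_f$, in the amount $P^f(x)=\sum_j P^f_j(x_j)$ from the raw materials $x$. All $U^i_j,P^f_j:[0,\infty)\to[0,\infty)$ are non-decreasing piecewise-linear concave and vanish at $0$; they are given by finitely many segments with non-negative, strictly decreasing slopes $u^i_{jk}$, $\alpha^f_{jk}$ ($k=1,2,\dots$) and positive lengths $l^i_{jk}$, $o^f_{jk}$, the last segment being infinitely long. **Equilibrium.** Prices $p\ge 0$, $p\ne0$, with bundles $X^i\ge0$ and raw materials $R^f\ge0$, form an equilibrium if each $R^f$ maximizes the profit $p_{j_f}P^f(x)-p\cdot x$ over $x\ge0$; each $X^i$ maximizes $U^i$ over the bundles $x\ge 0$ whose cost $p\cdot x$ is at most the sum of $w^i\cdot p$ and the agent's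 shares of the profits; and $\sum_iX^i_j+\sum_fR^f_j=1+\sum_{f:j_f=j}P^f(R^f)$ for all $j$. **Conditions.** * *No production out of nothing:* in the graph on $\mathcal G$ in which the edge from $j$ to $j'$ has weight $\max_{f:\,j_f=j'}\alpha^f_{j1}$, the weights on every cycle multiply to less than $1$. * *Strong connectivity:* in the graph on $\mathcal A\cup\mathcal F$ with an edge from $a$ to $b$ whenever some good possessed (agent) or produced (firm) by $a$ has a last segment of positive slope for $b$, one strongly connected component contains all agents. * *Enough demand:* let $L=n^n(\alpha_{\max}+1)^n$, where $\alpha_{\max}$ is the largest and $\alpha_{\min}$ the smallest non-zero $\alpha^f_{jk}$ ($0$ if there is none). From here on, in $l$ and $o$, replace the infinite length of each last utility segment by $L+1$ and of each last production segment by $L/\max\{1,\alpha_{\min}\}$. Then $\sum_{(i,k):\,u^i_{jk}>0}l^i_{jk}>1$ for every good $j$. **NHAD-LCP′.** Let $\mathcal C=\{c: c_j\ge1,\ \alpha^f_{jk}c_{j_f}\le c_j\ \forall f,j,k\}$ and $c\in\operatorname{int}\mathcal C$. In the variables $y=(p',\lambda,q,\gamma,r,\beta)\ge0$ and $z\ge0$,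 with $p=p'+c$, $s^f_{jk}=r^f_{jk}+o^f_{jk}\beta^f_{jk}$ and $E^f=\sum_{j,k}o^f_{jk}\beta^f_{jk}$, the inequalities are as follows, each complementary to the variable in brackets: * $\sum_{i,k}q^i_{jk}+\sum_{f,k}r^f_{jk}\le p_j+\sum_{f:j_f=j}\sum_{j',k}s^f_{j'k}$ $[p'_j]$; * $\sum_jw^i_jp_j+\sum_f\theta^i_fE^f-\sum_{j,k}q^i_{jk}-z\le 0$ $[\lambda_i]$; * $u^i_{jk}\lambda_i\le p_j+\gamma^i_{jk}$ $[q^i_{jk}]$; * $q^i_{jk}\le l^i_{jk}p_j$ $[\gamma^i_{jk}]$; * $\alpha^f_{jk}p_{j_f}-p_j\le\beta^f_{jk}$ $[r^f_{jk}]$; * $r^f_{jk}\le o^f_{jk}p_j$ $[\beta^f_{jk}]$. Let $N$ be the number of coordinates of $y$, and let $\mathcal P'$ be the polyhedron of all these inequalities without complementarity. Call the problem *non-degenerate* if every vertex of $\mathcal P'$ with $z>0$ that satisfies all complementarity conditions makes exactly $N+1$ of the $2N+1$ inequalities (those above, $y\ge0$ and $z\ge 0$) tight. (The polyhedron always has degeneracies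 at $z=0$; they are allowed.) **Algorithm.** Start at the vertex $y=0$, $z=\max_i\sum_jw^i_jc_j$, regarded as reached along the ray $y=0$ from larger $z$. While $z>0$, take a double label, that is, a variable which is $0$ while its complementary inequality is tight. If that inequality has just become tight along the edge last traversed, relax the variable; otherwise relax the inequality. Keep the other tight constraints, and move along the resulting edge of $\mathcal P'$ to its other vertex; if there is none, output "Secondary ray" and exit. When $z=0$, output the current point. **Theorem.** Let $\mathcal M$ satisfy strong connectivity, no production out of nothing and enough demand. Then $\mathcal M$ has an equilibrium. Moreover $\operatorname{int}\mathcal C\ne\emptyset$, and for every $c\in\operatorname{int}\mathcal C$ for which NHAD-LCP′ is non-degenerate, the algorithm terminates, never gets stuck without a double label and never outputs "Secondary ray", and its output gives an equilibrium with $p=p'+c$, $X^i_j=\sum_kq^i_{jk}/p_j$ and $R^f_j=\sum_kr^f_{jk}/p_j$. -/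

import Mathlib

/-! ### Complementary pivoting for a linear complementarity problem with one artificial variable -/

/-- The augmented linear complementarity problem in the unknowns `(y, z)`:
`M y - z d ≤ q`, `y ≥ 0`, `z ≥ 0`, `yᵢ (M y - z d - q)ᵢ = 0` for every `i`. -/
structure AugLCP (ι : Type*) where
  M : (ι → ℝ) →ₗ[ℝ] (ι → ℝ)
  q : ι → ℝ
  d : ι → ℝ

/-- Configurations of the pivoting algorithm: it is at the vertex `cur`, which it has reached along
an edge containing `prev`; or it has output a point; or it has output `Secondary ray`. -/
inductive PivotConfig (ι : Type*) where
  | run (prev cur : (ι → ℝ) × ℝ)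
  | output (x : (ι → ℝ) × ℝ)
  | secondaryRay

namespace AugLCP

variable {ι : Type*} (L : AugLCP ι)

/-- The slack of the `i`-th inequality `(M y - z d)ᵢ ≤ qᵢ` at the point `x = (y, z)`. -/
def slack (x : (ι → ℝ) × ℝ) (i : ι) : ℝ := L.q i + x.2 * L.d i - L.M x.1 i

/-- The polyhedron of the augmented problem (complementarity dropped). -/
def polyhedron : Set ((ι → ℝ) × ℝ) :=
  {x | (∀ i, 0 ≤ x.1 i) ∧ (∀ i, 0 ≤ L.slack x i) ∧ 0 ≤ x.2}

/-- Solutions of the augmented problem. -/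
def IsSolution (x : (ι → ℝ) × ℝ) : Prop :=
  x ∈ L.polyhedron ∧ ∀ i, x.1 i * L.slack x i = 0

/-- Vertices of the polyhedron. -/
def IsVertex (x : (ι → ℝ) × ℝ) : Prop := x ∈ Set.extremePoints ℝ L.polyhedron

/-- Non-degeneracy away from `z = 0`: a vertex with `z > 0` that solves the augmented problem
satisfies exactly as many of the inequalities with equality as there are unknowns
(`z ≥ 0` is not among them, because `z > 0`). Nothing is asked at points with `z = 0`, nor at
vertices that are not solutions. -/
def Nondegenerate : Prop :=
  ∀ x, L.IsVertex x → L.IsSolution x → 0 < x.2 →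
    {i | x.1 i = 0}.ncard + {i | L.slack x i = 0}.ncard = Nat.card ι + 1

/-- `i` is a double label at `x = (y, z)`: both `yᵢ = 0` and the `i`-th inequality is tight. -/
def DoubleLabel (x : (ι → ℝ) × ℝ) (i : ι) : Prop := x.1 i = 0 ∧ L.slack x i = 0

/-- The face of the polyhedron obtained from a vertex `x` with `z > 0` by keeping all inequalities
that are tight at `x`, except that `yᵢ = 0` is relaxed. -/
def relaxVar (x : (ι → ℝ) × ℝ) (i : ι) : Set ((ι → ℝ) × ℝ) :=
  {x' | x' ∈ L.polyhedron ∧ (∀ k, k ≠ i → x.1 k = 0 → x'.1 k = 0) ∧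
    ∀ k, L.slack x k = 0 → L.slack x' k = 0}

/-- The face of the polyhedron obtained from a vertex `x` with `z > 0` by keeping all inequalities
that are tight at `x`, except that tightness of the `i`-th inequality is relaxed. -/
def relaxSlack (x : (ι → ℝ) × ℝ) (i : ι) : Set ((ι → ℝ) × ℝ) :=
  {x' | x' ∈ L.polyhedron ∧ (∀ k, x.1 k = 0 → x'.1 k = 0) ∧
    ∀ k, k ≠ i → L.slack x k = 0 → L.slack x' k = 0}

/-- The edge along which the algorithm leaves `cur`, which has the double label `i` and was reached
from `prev`. If the `i`-th slack just became `0` (it was positive at `prev`, hence along the edge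
just traversed), then `yᵢ = 0` is relaxed, otherwise the tightness of the `i`-th inequality. -/
noncomputable def pivotEdge (prev cur : (ι → ℝ) × ℝ) (i : ι) : Set ((ι → ℝ) × ℝ) :=
  if 0 < L.slack prev i then L.relaxVar cur i else L.relaxSlack cur i

/-- One step of the complementary pivot algorithm. -/
inductive Step : PivotConfig ι → PivotConfig ι → Prop
  | finish {prev cur : (ι → ℝ) × ℝ} (hz : cur.2 = 0) :
      Step (.run prev cur) (.output cur)
  | pivot {prev cur next : (ι → ℝ) × ℝ} {i : ι} (hz : 0 < cur.2) (hi : L.DoubleLabel cur i)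
      (hnext : next ∈ L.pivotEdge prev cur i) (hne : next ≠ cur) (hv : L.IsVertex next) :
      Step (.run prev cur) (.run cur next)
  | ray {prev cur : (ι → ℝ) × ℝ} {i : ι} (hz : 0 < cur.2) (hi : L.DoubleLabel cur i)
      (hray : ∀ next ∈ L.pivotEdge prev cur i, L.IsVertex next → next = cur) :
      Step (.run prev cur) .secondaryRay

/-- Started in `s₀`, the algorithm terminates with an output satisfying `Q`: there is no infinite
execution, and every execution that cannot be continued has ended by outputting a point with `Q`
(so it is neither stuck without a double label, nor has it output `Secondary ray`). -/
def TerminatesWith (s₀ : PivotConfig ι) (Q : (ι → ℝ) × ℝ → Prop) : Prop :=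
  Acc (fun s' s => L.Step s s') s₀ ∧
    ∀ s, Relation.ReflTransGen L.Step s₀ s → (∀ s', ¬ L.Step s s') → ∃ x, s = .output x ∧ Q x

end AugLCP

/-! ### Piecewise-linear concave functions -/

/-- A non-decreasing piecewise-linear concave function on `[0, ∞)` vanishing at `0`, given by its
segments: `m` bounded segments of lengths `len 0, …, len (m - 1)`, followed by an unbounded one, the
slopes being non-negative and strictly decreasing. -/
structure PLC where
  m : ℕ
  slope : Fin (m + 1) → ℝ
  len : Fin m → ℝ
  slope_nonneg : ∀ k, 0 ≤ slope k
  slope_strictAnti : StrictAnti slope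
  len_pos : ∀ k, 0 < len k

namespace PLC

variable (P : PLC)

/-- Left endpoint of the domain of a segment. -/
def start (k : Fin (P.m + 1)) : ℝ := ∑ k' : Fin P.m with k'.castSucc < k, P.len k'

/-- Value of the function at `x ≥ 0`: each segment contributes its slope times the length of the
part of `[0, x]` that lies in its domain. -/
noncomputable def eval (x : ℝ) : ℝ :=
  ∑ k : Fin P.m, P.slope k.castSucc * min (P.len k) (max 0 (x - P.start k.castSucc)) +
    P.slope (Fin.last P.m) * max 0 (x - P.start (Fin.last P.m))

/-- The lengths of the segments, with the infinite length of the last one replaced by `B`. -/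
def lenTrunc (B : ℝ) : Fin (P.m + 1) → ℝ := Fin.snoc (α := fun _ => ℝ) P.len B

end PLC

/-! ### Markets -/

/-- An Arrow-Debreu market with agents `A`, firms `F`, goods `G`, separable piecewise-linear concave
utilities and separable piecewise-linear concave production. -/
structure Market (A F G : Type*) [Fintype A] where
  /-- utility of an agent as a function of the amount of a good -/
  util : A → G → PLC
  /-- the good produced by a firm -/
  out : F → G
  /-- amount a firm produces as a function of the amount of a raw good -/
  prod : F → G → PLC
  /-- initial endowments -/
  endow : A → G → ℝ
  endow_nonneg : ∀ i j, 0 ≤ endow i j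
  endow_sum : ∀ j, ∑ i, endow i j = 1
  /-- profit shares -/
  share : A → F → ℝ
  share_nonneg : ∀ i f, 0 ≤ share i f
  share_sum : ∀ f, ∑ i, share i f = 1

namespace Market

variable {A F G : Type*} [Fintype A] [Fintype F] [Fintype G] [DecidableEq G] (M : Market A F G)

/-! #### Equilibria -/

/-- Amount of the good `M.out f` that firm `f` produces from the bundle `x`. -/
noncomputable def production (f : F) (x : G → ℝ) : ℝ := ∑ j, (M.prod f j).eval (x j)

/-- Profit of firm `f` at prices `p` when it uses the bundle `x` as raw material. -/
noncomputable def profit (p : G → ℝ) (f : F) (x : G → ℝ) : ℝ :=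
  p (M.out f) * M.production f x - ∑ j, p j * x j

/-- Utility of agent `i` for the bundle `x`. -/
noncomputable def utility (i : A) (x : G → ℝ) : ℝ := ∑ j, (M.util i j).eval (x j)

/-- Earnings of agent `i` at prices `p` when the firms use the raw materials `R`. -/
noncomputable def income (p : G → ℝ) (R : F → G → ℝ) (i : A) : ℝ :=
  ∑ j, M.endow i j * p j + ∑ f, M.share i f * M.profit p f (R f)

/-- The prices `p`, the bundles `X i` bought by the agents and the raw materials `R f` used by the
firms form a market equilibrium: every firm maximizes its profit, every agent buys a bundle of
maximal utility among those that she can afford, and there is neither deficiency nor surplus of any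
good. -/
structure IsEquilibrium (p : G → ℝ) (X : A → G → ℝ) (R : F → G → ℝ) : Prop where
  price_nonneg : ∀ j, 0 ≤ p j
  price_ne_zero : p ≠ 0
  raw_nonneg : ∀ f j, 0 ≤ R f j
  raw_optimal : ∀ f (x : G → ℝ), (∀ j, 0 ≤ x j) → M.profit p f x ≤ M.profit p f (R f)
  bundle_nonneg : ∀ i j, 0 ≤ X i j
  bundle_affordable : ∀ i, ∑ j, p j * X i j ≤ M.income p R i
  bundle_optimal : ∀ i (x : G → ℝ), (∀ j, 0 ≤ x j) → ∑ j, p j * x j ≤ M.income p R i →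
    M.utility i x ≤ M.utility i (X i)
  clearing : ∀ j, ∑ i, X i j + ∑ f, R f j =
    ∑ i, M.endow i j + ∑ f with M.out f = j, M.production f (R f)

/-! #### The sufficiency conditions -/

/-- No production out of nothing (and no vacuous production): in the graph on the goods in which the
weight of an edge from `j` to `j'` is the largest rate (slope of the first segment) at which a firm
producing `j'` can turn `j` into `j'`, the weights of the edges of every cycle multiply to less than
one. A cycle is a closed walk `g 0 → g 1 → ⋯ → g n → g 0` (indices in `Fin (n + 1)` are cyclic);
the condition on maximal weights is stated for every choice of firms `f t` producing
`g (t + 1)`. -/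
def NoProductionOutOfNothing : Prop :=
  ∀ (n : ℕ) (g : Fin (n + 1) → G) (f : Fin (n + 1) → F),
    (∀ t, M.out (f t) = g (t + 1)) → ∏ t, (M.prod (f t) (g t)).slope 0 < 1

/-- Good `j` is possessed by the agent, or produced by the firm. -/
def Supplies : A ⊕ F → G → Prop
  | .inl i, j => 0 < M.endow i j
  | .inr f, j => M.out f = j

/-- The agent or firm is non-satiated by good `j`: the last segment has positive slope. -/
def NonSatiated : A ⊕ F → G → Prop
  | .inl i, j => 0 < (M.util i j).slope (Fin.last _)
  | .inr f, j => 0 < (M.prod f j).slope (Fin.last _)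

/-- All agents lie in one strongly connected component of the graph on agents and firms that has an
edge from `a` to `b` if some good possessed or produced by `a` is one by which `b` is
non-satiated. -/
def StronglyConnected : Prop :=
  ∀ i i' : A, Relation.ReflTransGen
    (fun a b : A ⊕ F => ∃ j, M.Supplies a j ∧ M.NonSatiated b j) (.inl i) (.inl i')

/-- The largest production slope (`0` if there are no firms). -/
noncomputable def alphaMax : ℝ := sSup {a | ∃ f j k, a = (M.prod f j).slope k}

/-- The smallest non-zero production slope (`0` if there is none). -/
noncomputable def alphaMin : ℝ := sInf {a | a ≠ 0 ∧ ∃ f j k, a = (M.prod f j).slope k}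

/-- `L = nⁿ (α_max + 1)ⁿ`, where `n` is the number of goods. -/
noncomputable def bigL : ℝ :=
  (Fintype.card G : ℝ) ^ Fintype.card G * (M.alphaMax + 1) ^ Fintype.card G

/-- Lengths of the utility segments; that of the last one is set to `L + 1`. -/
noncomputable def utilLen (i : A) (j : G) : Fin ((M.util i j).m + 1) → ℝ :=
  (M.util i j).lenTrunc (M.bigL + 1)

/-- Lengths of the production segments; that of the last one is set to `L / max {1, α_min}`. -/
noncomputable def prodLen (f : F) (j : G) : Fin ((M.prod f j).m + 1) → ℝ :=
  (M.prod f j).lenTrunc (M.bigL / max 1 M.alphaMin)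

/-- Total length of the utility segments of positive slope for good `j`. -/
noncomputable def desire (j : G) : ℝ :=
  ∑ i, ∑ k, if 0 < (M.util i j).slope k then M.utilLen i j k else 0

/-- Enough demand. -/
def EnoughDemand : Prop := ∀ j, 1 < M.desire j

/-! #### The linear complementarity problem of the market -/

/-- The polyhedron of lower bounds on the prices: price vectors at least one at which no production
segment makes a positive profit. -/
def boundPolyhedron : Set (G → ℝ) :=
  {c | (∀ f j k, (M.prod f j).slope k * c (M.out f) ≤ c j) ∧ ∀ j, 1 ≤ c j}

/-- Variables of the problem; each also names the inequality complementary to it. -/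
inductive Var
  /-- `p'_j`, the price of good `j` minus its lower bound -/
  | price (j : G)
  /-- `λ_i` -/
  | lam (i : A)
  /-- `q^i_{jk}`, money spent by agent `i` on a segment -/
  | spend (i : A) (j : G) (k : Fin ((M.util i j).m + 1))
  /-- `γ^i_{jk}` -/
  | gam (i : A) (j : G) (k : Fin ((M.util i j).m + 1))
  /-- `r^f_{jk}`, money spent by firm `f` on raw material on a segment -/
  | raw (f : F) (j : G) (k : Fin ((M.prod f j).m + 1))
  /-- `β^f_{jk}` -/
  | beta (f : F) (j : G) (k : Fin ((M.prod f j).m + 1))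

/-- `s^f_{jk} = r^f_{jk} + o^f_{jk} β^f_{jk}`, the revenue of firm `f` on a segment. -/
noncomputable def revenue (y : M.Var → ℝ) (f : F) (j : G) (k : Fin ((M.prod f j).m + 1)) : ℝ :=
  y (.raw f j k) + M.prodLen f j k * y (.beta f j k)

/-- `E^f = ∑ o^f_{jk} β^f_{jk}`, the profit of firm `f`. -/
noncomputable def firmProfit (y : M.Var → ℝ) (f : F) : ℝ :=
  ∑ j, ∑ k, M.prodLen f j k * y (.beta f j k)

/-- Left-hand sides of the inequalities. -/
noncomputable def lhs (y : M.Var → ℝ) : M.Var → ℝ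
  | .price j => ∑ i, ∑ k, y (.spend i j k) + ∑ f, ∑ k, y (.raw f j k) - y (.price j) -
      ∑ f with M.out f = j, ∑ j', ∑ k, M.revenue y f j' k
  | .lam i => ∑ j, M.endow i j * y (.price j) + ∑ f, M.share i f * M.firmProfit y f -
      ∑ j, ∑ k, y (.spend i j k)
  | .spend i j k => (M.util i j).slope k * y (.lam i) - y (.price j) - y (.gam i j k)
  | .gam i j k => y (.spend i j k) - M.utilLen i j k * y (.price j)
  | .raw f j k => (M.prod f j).slope k * y (.price (M.out f)) - y (.price j) - y (.beta f j k)
  | .beta f j k => y (.raw f j k) - M.prodLen f j k * y (.price j)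

/-- Right-hand sides of the inequalities, for the lower bounds `c` on the prices. -/
noncomputable def rhs (c : G → ℝ) : M.Var → ℝ
  | .price j => c j
  | .lam i => -∑ j, M.endow i j * c j
  | .spend _ j _ => c j
  | .gam i j k => M.utilLen i j k * c j
  | .raw f j k => c j - (M.prod f j).slope k * c (M.out f)
  | .beta f j k => M.prodLen f j k * c j

/-- The inequalities in which the artificial variable `z` is subtracted on the left-hand side: those
of the agents' budgets. -/
def covering : M.Var → ℝ
  | .lam _ => 1
  | _ => 0

/-- The problem NHAD-LCP' of the market for the lower bounds `c` on the prices. -/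
noncomputable def nhadLCP (c : G → ℝ) : AugLCP M.Var where
  M :=
    { toFun := M.lhs
      map_add' := by
        intro x y
        funext v
        cases v <;>
          simp only [lhs, revenue, firmProfit, Pi.add_apply, mul_add, Finset.sum_add_distrib] <;>
          ring
      map_smul' := by
        intro a x
        funext v
        cases v <;>
          simp only [lhs, revenue, firmProfit, Pi.smul_apply, smul_eq_mul, RingHom.id_apply,
            mul_add, mul_sub, Finset.mul_sum, mul_left_comm] }
  q := M.rhs c
  d := M.covering

/-- The value of `z` at the initial vertex. -/
noncomputable def initialZ (c : G → ℝ) : ℝ := ⨆ i, ∑ j, M.endow i j * c j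

/-- The initial configuration: the current vertex is the endpoint `(0, max_i ∑_j w^i_j c_j)` of the
primary ray, reached along the primary ray. -/
noncomputable def initialConfig (c : G → ℝ) : PivotConfig M.Var :=
  .run (0, M.initialZ c + 1) (0, M.initialZ c)

/-- The prices `p = p' + c` encoded by a point. -/
def prices (c : G → ℝ) (x : (M.Var → ℝ) × ℝ) (j : G) : ℝ := x.1 (.price j) + c j

/-- The amounts of goods that the agents buy at a point. -/
noncomputable def bundles (c : G → ℝ) (x : (M.Var → ℝ) × ℝ) (i : A) (j : G) : ℝ :=
  (∑ k, x.1 (.spend i j k)) / M.prices c x j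

/-- The amounts of raw goods that the firms use at a point. -/
noncomputable def rawMaterials (c : G → ℝ) (x : (M.Var → ℝ) × ℝ) (f : F) (j : G) : ℝ :=
  (∑ k, x.1 (.raw f j k)) / M.prices c x j

end Market

/-- There are finitely many variables. -/
instance Market.instFiniteVar {A F G : Type*} [Fintype A] [Finite F] [Finite G]
    (M : Market A F G) : Finite M.Var := by
  have : Function.Surjective (fun s : G ⊕ A ⊕
      ((i : A) × (j : G) × Fin ((M.util i j).m + 1)) ⊕
      ((i : A) × (j : G) × Fin ((M.util i j).m + 1)) ⊕
      ((f : F) × (j : G) × Fin ((M.prod f j).m + 1)) ⊕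
      ((f : F) × (j : G) × Fin ((M.prod f j).m + 1)) =>
      (match s with
      | .inl j => Market.Var.price j
      | .inr (.inl i) => Market.Var.lam i
      | .inr (.inr (.inl ⟨i, j, k⟩)) => Market.Var.spend i j k
      | .inr (.inr (.inr (.inl ⟨i, j, k⟩))) => Market.Var.gam i j k
      | .inr (.inr (.inr (.inr (.inl ⟨f, j, k⟩)))) => Market.Var.raw f j k
      | .inr (.inr (.inr (.inr (.inr ⟨f, j, k⟩)))) => Market.Var.beta f j k : M.Var)) := by
    rintro (j | i | ⟨i, j, k⟩ | ⟨i, j, k⟩ | ⟨f, j, k⟩ | ⟨f, j, k⟩)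
    · exact ⟨.inl j, rfl⟩
    · exact ⟨.inr (.inl i), rfl⟩
    · exact ⟨.inr (.inr (.inl ⟨i, j, k⟩)), rfl⟩
    · exact ⟨.inr (.inr (.inr (.inl ⟨i, j, k⟩))), rfl⟩
    · exact ⟨.inr (.inr (.inr (.inr (.inl ⟨f, j, k⟩)))), rfl⟩
    · exact ⟨.inr (.inr (.inr (.inr (.inr ⟨f, j, k⟩)))), rfl⟩
  exact Finite.of_surjective _ this

/-!
The algorithm is Lemke's complementary pivoting. At a non-degenerate vertex with `z > 0` that
solves the problem (`AugLCP.IsNode`), as many constraints are tight as there are unknowns, so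
dropping one of them leaves one edge, and exactly one label is double. Hence such a vertex lies on
just two edges of solutions, the algorithm arrives along one and leaves along the other, and the
relation of being joined by such an edge is symmetric (`AugLCP.IsNode.mem_relax_symm`). So the
algorithm follows a path that starts with the primary ray and cannot visit a vertex twice
(`AugLCP.IsPath.ne_next`); as there are finitely many vertices, it stops, at a point with `z = 0`
or at a ray of solutions (`AugLCP.terminatesWith`).

For the problem of a market, the prices relative to strict lower bounds `c` increase strictly
along every segment of production in use. So production is acyclic in this order, which bounds the
available amounts of goods (`Market.supply_le_pow_rank`); the artificial lengths of the last
segments are therefore never exhausted, and a solution with `z = 0` is an equilibrium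
(`Market.isEquilibrium`), since by Walras' law all markets clear and the complementarity
conditions say that every segment with a better than break-even rate is full and every one with a
worse rate is empty.

It remains to exclude secondary rays (`Market.ray_cases`). If some price grows along a ray of
solutions, then strong connectivity passes the growth on to the spending power of all agents; if a
good kept its price, then all agents would exhaust their demand for it, which exceeds one unit,
while the relatively cheapest such good is not produced. So all prices and all spending powers
grow, hence all markets clear and all budgets are exhausted exactly, which contradicts `z > 0` by
Walras' law. If no price grows, then nothing but `z` does, and the ray is the primary one.

Existence of an equilibrium needs no non-degeneracy. The right-hand sides for which the problem is
non-degenerate are dense (`AugLCP.dense_nondegenerate`); those close to the given ones that create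
additional money admit no secondary ray, because a limit of such rays would be a ray for the given
problem, and the solutions found for them are bounded and accumulate at a solution with `z = 0`
(`AugLCP.exists_isSolution`).

Strict lower bounds exist because the weights of walks are bounded when no cycle has weight one or
more (`exists_potential`).
-/

set_option linter.unusedSectionVars false

open Filter Topology

namespace AugLCP

variable {ι : Type*} (L : AugLCP ι)

/-! ### Edges of the polyhedron -/

/-- The constraints of the problem other than `z ≥ 0`, as functions that have to be non-negative:
`Sum.inl i` is the variable `yᵢ` and `Sum.inr i` is the slack of the `i`-th inequality. -/
def con : ι ⊕ ι → (ι → ℝ) × ℝ → ℝ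
  | .inl i, x => x.1 i
  | .inr i, x => L.slack x i

/-- The linear part of the affine function `L.con e`. -/
def lin : ι ⊕ ι → ((ι → ℝ) × ℝ →ₗ[ℝ] ℝ)
  | .inl i => LinearMap.proj i ∘ₗ LinearMap.fst ℝ _ _
  | .inr i => L.d i • LinearMap.snd ℝ _ _ - LinearMap.proj i ∘ₗ L.M ∘ₗ LinearMap.fst ℝ _ _

@[simp] lemma lin_inl (i : ι) (v : (ι → ℝ) × ℝ) : L.lin (.inl i) v = v.1 i := rfl

lemma lin_inr (i : ι) (v : (ι → ℝ) × ℝ) : L.lin (.inr i) v = v.2 * L.d i - L.M v.1 i := by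
  simp [lin, mul_comm]

lemma con_add (e : ι ⊕ ι) (x v : (ι → ℝ) × ℝ) : L.con e (x + v) = L.con e x + L.lin e v := by
  cases e with
  | inl i => simp [con]
  | inr i =>
    rw [lin_inr]
    simp only [con, slack, Prod.fst_add, Prod.snd_add, map_add, Pi.add_apply]
    ring

lemma con_add_smul (e : ι ⊕ ι) (x v : (ι → ℝ) × ℝ) (t : ℝ) :
    L.con e (x + t • v) = L.con e x + t * L.lin e v := by
  rw [con_add, map_smul, smul_eq_mul]

lemma lin_sub (e : ι ⊕ ι) (x x' : (ι → ℝ) × ℝ) : L.lin e (x' - x) = L.con e x' - L.con e x := by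
  have := L.con_add e x (x' - x)
  rw [add_sub_cancel] at this
  linarith

lemma mem_polyhedron {x : (ι → ℝ) × ℝ} : x ∈ L.polyhedron ↔ (∀ e, 0 ≤ L.con e x) ∧ 0 ≤ x.2 := by
  simp [polyhedron, con, and_assoc]

/-- The face of the polyhedron on which all constraints tight at `x`, except for `e`, stay tight. -/
def relax (x : (ι → ℝ) × ℝ) (e : ι ⊕ ι) : Set ((ι → ℝ) × ℝ) :=
  {x' | x' ∈ L.polyhedron ∧ ∀ e', e' ≠ e → L.con e' x = 0 → L.con e' x' = 0}

lemma relaxVar_eq (x : (ι → ℝ) × ℝ) (i : ι) : L.relaxVar x i = L.relax x (.inl i) := by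
  ext; simp [relaxVar, relax, con]

lemma relaxSlack_eq (x : (ι → ℝ) × ℝ) (i : ι) : L.relaxSlack x i = L.relax x (.inr i) := by
  ext; simp [relaxSlack, relax, con]

variable {L}

lemma eventually_mem_polyhedron [Finite ι] {x v : (ι → ℝ) × ℝ} (hx : x ∈ L.polyhedron)
    (hv : ∀ e, L.con e x = 0 → 0 ≤ L.lin e v) (hz : x.2 = 0 → 0 ≤ v.2) :
    ∀ᶠ t : ℝ in 𝓝[>] 0, x + t • v ∈ L.polyhedron := by
  have key : ∀ a b : ℝ, 0 ≤ a → (a = 0 → 0 ≤ b) → ∀ᶠ t : ℝ in 𝓝[>] 0, 0 ≤ a + t * b := by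
    intro a b ha hab
    rcases ha.eq_or_lt with h | h
    · filter_upwards [self_mem_nhdsWithin] with t ht
      have := mul_nonneg (le_of_lt ht) (hab h.symm)
      linarith
    · have : Tendsto (fun t : ℝ => a + t * b) (𝓝 0) (𝓝 (a + 0 * b)) := by
        apply Continuous.tendsto; fun_prop
      exact nhdsWithin_le_nhds
        ((this.eventually_const_lt (by simpa using h)).mono fun _ => le_of_lt)
  rw [mem_polyhedron] at hx
  filter_upwards [eventually_all.2 fun e => key _ (L.lin e v) (hx.1 e) (hv e), key _ _ hx.2 hz]
    with t h1 h2
  rw [mem_polyhedron]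
  exact ⟨fun e => by rw [con_add_smul]; exact h1 e, by simpa using h2⟩

/-- The constraints tight at a vertex have no common direction. -/
lemma IsVertex.eq_zero_of_lin_eq_zero [Finite ι] {x v : (ι → ℝ) × ℝ} (hx : L.IsVertex x)
    (hv : ∀ e, L.con e x = 0 → L.lin e v = 0) (hz : x.2 = 0 → v.2 = 0) : v = 0 := by
  have h1 := eventually_mem_polyhedron (v := v) hx.1 (fun e he => (hv e he).ge) fun h => (hz h).ge
  have h2 := eventually_mem_polyhedron (v := -v) hx.1
    (fun e he => by rw [map_neg, hv e he, neg_zero]) fun h => by simp [hz h]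
  obtain ⟨t, ⟨h1, h2⟩, ht⟩ := ((h1.and h2).and self_mem_nhdsWithin).exists
  have := ((mem_extremePoints.1 hx).2 _ h1 _ h2
    ⟨1/2, 1/2, by norm_num, by norm_num, by norm_num, by simp only [smul_neg]; module⟩).1
  have h3 : t • v = 0 := by simpa using this
  exact (smul_eq_zero.1 h3).resolve_left (ne_of_gt ht)

lemma not_isVertex_of_mid {x v : (ι → ℝ) × ℝ} {s t : ℝ} (hx : x ∈ L.polyhedron)
    (hs : 0 < s) (hst : s < t) (hv : v ≠ 0) (ht : x + t • v ∈ L.polyhedron) :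
    ¬ L.IsVertex (x + s • v) := by
  intro hvert
  have htpos : 0 < t := hs.trans hst
  have := ((mem_extremePoints.1 hvert).2 _ hx _ ht
    ⟨1 - s / t, s / t, by rw [sub_pos, div_lt_one htpos]; exact hst, by positivity, by ring, by
      have : (s / t) * t = s := by field_simp
      rw [smul_add, smul_smul, this]; module⟩).1
  rw [left_eq_add, smul_eq_zero] at this
  exact this.elim hs.ne' hv

/-- The number of constraints other than `z ≥ 0` that are tight at a point. -/
lemma card_tight [Finite ι] (x : (ι → ℝ) × ℝ) :
    Nat.card {e // L.con e x = 0} = {i | x.1 i = 0}.ncard + {i | L.slack x i = 0}.ncard := by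
  rw [Nat.card_congr (Equiv.subtypeSum (p := fun e => L.con e x = 0)), Nat.card_sum]
  rfl

lemma finrank_prod_real [Finite ι] : Module.finrank ℝ ((ι → ℝ) × ℝ) = Nat.card ι + 1 := by
  cases nonempty_fintype ι
  simp

/-- The values of the linear parts of the constraints tight at `x`. -/
noncomputable def tightMap (L : AugLCP ι) (x : (ι → ℝ) × ℝ) :
    ((ι → ℝ) × ℝ) →ₗ[ℝ] ({e // L.con e x = 0} → ℝ) :=
  LinearMap.pi fun e => L.lin e.1

lemma IsVertex.tightMap_injective [Finite ι] {x : (ι → ℝ) × ℝ} (hx : L.IsVertex x)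
    (hz : 0 < x.2) : Function.Injective (L.tightMap x) := by
  rw [injective_iff_map_eq_zero]
  intro v hv
  exact hx.eq_zero_of_lin_eq_zero (fun e he => congrFun hv ⟨e, he⟩) fun h => absurd h hz.ne'

/-- A vertex with `z > 0` solving the problem: a place that the algorithm leaves along an edge. -/
structure IsNode (L : AugLCP ι) (x : (ι → ℝ) × ℝ) : Prop where
  vertex : L.IsVertex x
  sol : L.IsSolution x
  pos : 0 < x.2

variable [Finite ι]

/-- Dropping one of the constraints tight at a non-degenerate node leaves exactly one direction. -/
lemma IsNode.exists_dir {x : (ι → ℝ) × ℝ} (hx : L.IsNode x) (hL : L.Nondegenerate) {e : ι ⊕ ι}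
    (he : L.con e x = 0) :
    ∃ v, L.lin e v = 1 ∧ ∀ e', e' ≠ e → L.con e' x = 0 → L.lin e' v = 0 := by
  classical
  cases nonempty_fintype (ι ⊕ ι)
  have hdim : Module.finrank ℝ ((ι → ℝ) × ℝ) =
      Module.finrank ℝ ({e // L.con e x = 0} → ℝ) := by
    rw [finrank_prod_real, Module.finrank_pi, ← Nat.card_eq_fintype_card, card_tight,
      hL x hx.vertex hx.sol hx.pos]
  obtain ⟨v, hv⟩ := (LinearMap.injective_iff_surjective_of_finrank_eq_finrank hdim).1
    (hx.vertex.tightMap_injective hx.pos) (Pi.single ⟨e, he⟩ 1)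
  refine ⟨v, ?_, fun e' hne he' => ?_⟩
  · have := congrFun hv ⟨e, he⟩
    rwa [Pi.single_eq_same] at this
  · have := congrFun hv ⟨e', he'⟩
    rwa [Pi.single_eq_of_ne (by simpa using hne)] at this

lemma IsNode.eq_of_con_eq_zero {x x' : (ι → ℝ) × ℝ} (hx : L.IsNode x)
    (h : ∀ e, L.con e x = 0 → L.con e x' = 0) : x' = x := by
  refine sub_eq_zero.1 (hx.vertex.eq_zero_of_lin_eq_zero (fun e he => ?_)
    fun h => absurd h hx.pos.ne')
  rw [lin_sub, h e he, he, sub_zero]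

lemma IsNode.con_pos {x x' : (ι → ℝ) × ℝ} (hx : L.IsNode x) {e : ι ⊕ ι}
    (h : x' ∈ L.relax x e) (hne : x' ≠ x) : 0 < L.con e x' := by
  refine ((L.mem_polyhedron.1 h.1).1 e).lt_of_ne
    fun h0 => hne (hx.eq_of_con_eq_zero fun e' he' => ?_)
  by_cases hee : e' = e
  · rw [hee, ← h0]
  · exact h.2 e' hee he'

lemma IsNode.eq_of_mem_relax_relax {x x' : (ι → ℝ) × ℝ} (hx : L.IsNode x) {e e' : ι ⊕ ι}
    (hee : e ≠ e') (h : x' ∈ L.relax x e) (h' : x' ∈ L.relax x e') : x' = x := by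
  refine hx.eq_of_con_eq_zero fun e₁ he₁ => ?_
  by_cases h1 : e₁ = e
  · exact h'.2 e₁ (h1 ▸ hee) he₁
  · exact h.2 e₁ h1 he₁

/-- A face obtained by relaxing one constraint at a node lies on the half-line spanned by any of its
points other than the node. -/
lemma IsNode.eq_add_smul {x v x' : (ι → ℝ) × ℝ} (hx : L.IsNode x) {e : ι ⊕ ι}
    (hv1 : L.lin e v = 1) (hv : ∀ e', e' ≠ e → L.con e' x = 0 → L.lin e' v = 0)
    (h : x' ∈ L.relax x e) :
    x' = x + L.con e x' • v := by
  rw [← sub_eq_iff_eq_add', ← sub_eq_zero]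
  refine hx.vertex.eq_zero_of_lin_eq_zero (fun e₁ he₁ => ?_) fun h => absurd h hx.pos.ne'
  rw [map_sub, lin_sub, map_smul, he₁, sub_zero, smul_eq_mul]
  by_cases h1 : e₁ = e
  · rw [h1, hv1]; ring
  · rw [h.2 e₁ h1 he₁, hv e₁ h1 he₁]; ring

/-- An edge at a node has at most one other vertex. -/
lemma IsNode.vertex_unique {x x₁ x₂ : (ι → ℝ) × ℝ} (hx : L.IsNode x) (hL : L.Nondegenerate)
    {e : ι ⊕ ι} (he : L.con e x = 0) (h₁ : x₁ ∈ L.relax x e) (h₂ : x₂ ∈ L.relax x e)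
    (hne₁ : x₁ ≠ x) (hne₂ : x₂ ≠ x) (hv₁ : L.IsVertex x₁) (hv₂ : L.IsVertex x₂) : x₁ = x₂ := by
  obtain ⟨v, hv1, hv⟩ := hx.exists_dir hL he
  have hv0 : v ≠ 0 := by rintro rfl; simp at hv1
  have e₁ := hx.eq_add_smul hv1 hv h₁
  have e₂ := hx.eq_add_smul hv1 hv h₂
  have p₁ := hx.con_pos h₁ hne₁
  have p₂ := hx.con_pos h₂ hne₂
  rcases lt_trichotomy (L.con e x₁) (L.con e x₂) with h | h | h
  · exact absurd (e₁ ▸ hv₁) (not_isVertex_of_mid hx.vertex.1 p₁ h hv0 (e₂ ▸ h₂.1))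
  · rw [e₁, h, ← e₂]
  · exact absurd (e₂ ▸ hv₂) (not_isVertex_of_mid hx.vertex.1 p₂ h hv0 (e₁ ▸ h₁.1))

/-- An edge at a node that is not a ray ends in another vertex. -/
lemma IsNode.exists_vertex_or_ray {x : (ι → ℝ) × ℝ} (hx : L.IsNode x) (hL : L.Nondegenerate)
    {e : ι ⊕ ι} (he : L.con e x = 0) :
    (∃ x', x' ∈ L.relax x e ∧ x' ≠ x ∧ L.IsVertex x') ∨
      ∃ v, L.lin e v = 1 ∧ (∀ e', e' ≠ e → L.con e' x = 0 → L.lin e' v = 0) ∧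
        ∀ t : ℝ, 0 ≤ t → x + t • v ∈ L.polyhedron := by
  obtain ⟨v, hv1, hv⟩ := hx.exists_dir hL he
  have hv0 : v ≠ 0 := by rintro rfl; simp at hv1
  by_cases hray : ∀ t : ℝ, 0 ≤ t → x + t • v ∈ L.polyhedron
  · exact .inr ⟨v, hv1, hv, hray⟩
  left
  push Not at hray
  obtain ⟨t₀, ht₀, hnot⟩ := hray
  set S : Set ℝ := {t | x + t • v ∈ L.polyhedron} with hS
  have hSeq : S = (⋂ e, {t | 0 ≤ L.con e x + t * L.lin e v}) ∩ {t | 0 ≤ x.2 + t * v.2} := by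
    ext t
    simp [hS, mem_polyhedron, con_add_smul]
  have hclosed : IsClosed S := by
    rw [hSeq]
    refine (isClosed_iInter fun e => ?_).inter ?_ <;>
      exact isClosed_le continuous_const (by fun_prop)
  have h0S : (0 : ℝ) ∈ S := by simpa [hS] using hx.vertex.1
  have hconv : ∀ s ∈ S, 0 ≤ s → ∀ t, 0 ≤ t → t ≤ s → t ∈ S := by
    intro s hs hs0 t ht hts
    have key : ∀ a b : ℝ, 0 ≤ a → 0 ≤ a + s * b → 0 ≤ a + t * b := by
      intro a b ha hab
      rcases le_total 0 b with hb | hb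
      · positivity
      · nlinarith
    have hx' := L.mem_polyhedron.1 hx.vertex.1
    rw [hS, Set.mem_ofPred_eq, mem_polyhedron] at hs ⊢
    refine ⟨fun e => ?_, ?_⟩
    · have := hs.1 e
      rw [con_add_smul] at this ⊢
      exact key _ _ (hx'.1 e) this
    · have := hs.2
      simp only [Prod.snd_add, Prod.smul_snd, smul_eq_mul] at this ⊢
      exact key _ _ hx'.2 this
  have hbdd : BddAbove S := ⟨t₀, fun s hs => by
    by_contra h
    exact hnot (hconv s hs (ht₀.trans (le_of_not_ge h)) t₀ ht₀ (le_of_not_ge h))⟩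
  set T := sSup S
  have hT : T ∈ S := hclosed.csSup_mem ⟨0, h0S⟩ hbdd
  have hTpos : 0 < T := by
    have hev : ∀ᶠ t : ℝ in 𝓝[>] 0, x + t • v ∈ L.polyhedron := by
      refine eventually_mem_polyhedron hx.vertex.1 (fun e' he' => ?_) fun h => absurd h hx.pos.ne'
      by_cases h : e' = e
      · rw [h, hv1]; exact zero_le_one
      · rw [hv e' h he']
    obtain ⟨t, ht, htpos⟩ := (hev.and self_mem_nhdsWithin).exists
    exact lt_of_lt_of_le htpos (le_csSup hbdd ht)
  have hcon : ∀ e', e' ≠ e → L.con e' x = 0 → L.con e' (x + T • v) = 0 := by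
    intro e' hne he'
    rw [con_add_smul, he', hv e' hne he']; ring
  refine ⟨x + T • v, ⟨hT, hcon⟩, by simpa using ⟨hTpos.ne', hv0⟩, mem_extremePoints.2 ⟨hT, ?_⟩⟩
  rintro a ha b hb ⟨s, r, hs, hr, hsr, hab⟩
  have hcomb : ∀ e', L.con e' (x + T • v) = s * L.con e' a + r * L.con e' b := by
    intro e'
    have h1 := L.lin_sub e' (x + T • v) a
    have h2 := L.lin_sub e' (x + T • v) b
    have h3 : s • (a - (x + T • v)) + r • (b - (x + T • v)) = 0 := by
      rw [smul_sub, smul_sub, sub_add_sub_comm, hab, ← add_smul, hsr, one_smul, sub_self]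
    have h4 := congrArg (L.lin e') h3
    rw [map_add, map_smul, map_smul, h1, h2, map_zero] at h4
    simp only [smul_eq_mul] at h4
    linear_combination L.con e' (x + T • v) * (-hsr) - h4
  have hab0 : ∀ e', e' ≠ e → L.con e' x = 0 → L.con e' a = 0 ∧ L.con e' b = 0 := by
    intro e' hne he'
    have h1 := hcomb e'
    rw [hcon e' hne he'] at h1
    have ha' := mul_nonneg hs.le ((L.mem_polyhedron.1 ha).1 e')
    have hb' := mul_nonneg hr.le ((L.mem_polyhedron.1 hb).1 e')
    exact ⟨(mul_eq_zero.1 (by linarith : s * L.con e' a = 0)).resolve_left hs.ne',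
      (mul_eq_zero.1 (by linarith : r * L.con e' b = 0)).resolve_left hr.ne'⟩
  have ea := hx.eq_add_smul hv1 hv (x' := a) ⟨ha, fun e' hne he' => (hab0 e' hne he').1⟩
  have eb := hx.eq_add_smul hv1 hv (x' := b) ⟨hb, fun e' hne he' => (hab0 e' hne he').2⟩
  have la : L.con e a ≤ T := le_csSup hbdd (by rw [hS, Set.mem_ofPred_eq, ← ea]; exact ha)
  have lb : L.con e b ≤ T := le_csSup hbdd (by rw [hS, Set.mem_ofPred_eq, ← eb]; exact hb)
  have hTc := hcomb e
  rw [con_add_smul, he, hv1, zero_add, mul_one] at hTc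
  have hTsum : T = s * T + r * T := by rw [← add_mul, hsr, one_mul]
  have := mul_nonneg hs.le (sub_nonneg.2 la)
  have := mul_nonneg hr.le (sub_nonneg.2 lb)
  have ha' : s * (T - L.con e a) = 0 := by linarith
  have hb' : r * (T - L.con e b) = 0 := by linarith
  have ha'' := (mul_eq_zero.1 ha').resolve_left hs.ne'
  have hb'' := (mul_eq_zero.1 hb').resolve_left hr.ne'
  constructor
  · rw [ea, ← sub_eq_zero.1 ha'']
  · rw [eb, ← sub_eq_zero.1 hb'']

end AugLCP

namespace AugLCP

variable {ι : Type*} {L : AugLCP ι}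

/-! ### Termination of the pivoting algorithm -/

/-- A direction in which the solutions of the problem contain a ray starting at `x`. -/
structure IsRay (L : AugLCP ι) (x v : (ι → ℝ) × ℝ) : Prop where
  nonneg : ∀ i, 0 ≤ v.1 i
  lin_nonneg : ∀ i, 0 ≤ L.lin (.inr i) v
  z_nonneg : 0 ≤ v.2
  mul_lin : ∀ i, x.1 i * L.lin (.inr i) v = 0
  mul_slack : ∀ i, v.1 i * L.slack x i = 0
  mul_self : ∀ i, v.1 i * L.lin (.inr i) v = 0

lemma nonneg_of_ray {a b : ℝ} (h : ∀ t : ℝ, 0 ≤ t → 0 ≤ a + t * b) : 0 ≤ b := by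
  by_contra hb
  push Not at hb
  have h1 := h ((|a| + 1) / -b) (div_nonneg (by positivity) (by linarith))
  have h2 : (|a| + 1) / -b * b = -(|a| + 1) := by
    rw [div_neg, neg_mul, div_mul_cancel₀ _ hb.ne]
  rw [h2] at h1
  linarith [le_abs_self a]

lemma IsSolution.con_eq_zero_or {x : (ι → ℝ) × ℝ} (hx : L.IsSolution x) (e : ι ⊕ ι) :
    L.con e x = 0 ∨ L.con e.swap x = 0 := by
  cases e with
  | inl i => exact mul_eq_zero.1 (hx.2 i)
  | inr i => exact (mul_eq_zero.1 (hx.2 i)).symm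

lemma isSolution_iff {x : (ι → ℝ) × ℝ} :
    L.IsSolution x ↔ x ∈ L.polyhedron ∧ ∀ e, L.con e x = 0 ∨ L.con e.swap x = 0 :=
  ⟨fun h => ⟨h.1, h.con_eq_zero_or⟩, fun h => ⟨h.1, fun i => mul_eq_zero.2 (h.2 (.inl i))⟩⟩

lemma eq_or_eq_swap {e e' : ι ⊕ ι} (h : e.elim id id = e'.elim id id) : e = e' ∨ e = e'.swap := by
  cases e <;> cases e' <;> simp_all

lemma swap_ne (e : ι ⊕ ι) : e.swap ≠ e := by cases e <;> simp

/-- Relaxing one constraint of a doubly tight pair preserves complementarity. -/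
lemma IsSolution.of_mem_relax {x x' : (ι → ℝ) × ℝ} (hx : L.IsSolution x) {e : ι ⊕ ι}
    (he' : L.con e.swap x = 0) (h : x' ∈ L.relax x e) : L.IsSolution x' := by
  refine isSolution_iff.2 ⟨h.1, fun e₁ => ?_⟩
  have hs := h.2 _ (swap_ne e) he'
  by_cases h1 : e₁ = e
  · exact .inr (h1 ▸ hs)
  by_cases h2 : e₁ = e.swap
  · exact .inl (h2 ▸ hs)
  refine (hx.con_eq_zero_or e₁).imp (h.2 e₁ h1) (h.2 e₁.swap fun h3 => h2 ?_)
  rw [← h3, Sum.swap_swap]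

lemma IsSolution.isRay {x v : (ι → ℝ) × ℝ} (hx : L.IsSolution x) {e : ι ⊕ ι}
    (he' : L.con e.swap x = 0) (hv : ∀ e', e' ≠ e → L.con e' x = 0 → L.lin e' v = 0)
    (hray : ∀ t : ℝ, 0 ≤ t → x + t • v ∈ L.polyhedron) : L.IsRay x v := by
  have hnn : ∀ e, 0 ≤ L.lin e v := fun e => nonneg_of_ray fun t ht => by
    rw [← con_add_smul]; exact (L.mem_polyhedron.1 (hray t ht)).1 e
  have hpair : ∀ e₁ : ι ⊕ ι, (L.con e₁ x = 0 ∧ L.lin e₁ v = 0) ∨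
      (L.con e₁.swap x = 0 ∧ L.lin e₁.swap v = 0) := by
    intro e₁
    have hs := hv _ (swap_ne e) he'
    by_cases h1 : e₁ = e
    · exact .inr (h1 ▸ ⟨he', hs⟩)
    by_cases h2 : e₁ = e.swap
    · exact .inl (h2 ▸ ⟨he', hs⟩)
    refine (hx.con_eq_zero_or e₁).imp (fun h => ⟨h, hv _ h1 h⟩)
      (fun h => ⟨h, hv _ (fun h3 => h2 ?_) h⟩)
    rw [← h3, Sum.swap_swap]
  refine ⟨fun i => hnn (.inl i), fun i => hnn (.inr i), nonneg_of_ray (a := x.2) fun t ht => ?_,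
    fun i => ?_, fun i => ?_, fun i => ?_⟩
  · simpa using (hray t ht).2.2
  all_goals
    rcases hpair (.inl i) with ⟨h1, h2⟩ | ⟨h1, h2⟩
    all_goals
      simp only [con, lin_inl, Sum.swap_inl] at h1 h2
      simp [h1, h2]

/-- A non-degenerate node has exactly one double label. -/
lemma IsNode.existsUnique_doubleLabel [Finite ι] {x : (ι → ℝ) × ℝ} (hx : L.IsNode x)
    (hL : L.Nondegenerate) : ∃! i, L.DoubleLabel x i := by
  have h1 := Set.ncard_union_add_ncard_inter {i | x.1 i = 0} {i | L.slack x i = 0}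
    (Set.toFinite _) (Set.toFinite _)
  have h2 : {i | x.1 i = 0} ∪ {i | L.slack x i = 0} = Set.univ := by
    ext i; simpa using hx.sol.2 i
  rw [hL x hx.vertex hx.sol hx.pos, h2, Set.ncard_univ, add_right_inj, Set.ncard_eq_one] at h1
  obtain ⟨i, hi⟩ := h1
  have h3 : ∀ j, L.DoubleLabel x j ↔ j = i := fun j => by
    rw [← Set.mem_singleton_iff, ← hi]; rfl
  exact ⟨i, (h3 i).2 rfl, fun j hj => (h3 j).1 hj⟩

/-- `e` is a tight constraint of the double label of `x`. -/
def IsDouble (L : AugLCP ι) (x : (ι → ℝ) × ℝ) (e : ι ⊕ ι) : Prop :=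
  L.con e x = 0 ∧ L.con e.swap x = 0

lemma IsDouble.swap {x : (ι → ℝ) × ℝ} {e : ι ⊕ ι} (h : L.IsDouble x e) :
    L.IsDouble x e.swap := ⟨h.2, by rw [Sum.swap_swap]; exact h.1⟩

lemma IsDouble.doubleLabel {x : (ι → ℝ) × ℝ} {e : ι ⊕ ι} (h : L.IsDouble x e) :
    L.DoubleLabel x (e.elim id id) := by
  cases e with
  | inl i => exact h
  | inr i => exact ⟨h.2, h.1⟩

lemma IsNode.eq_or_eq_swap [Finite ι] {x : (ι → ℝ) × ℝ} (hx : L.IsNode x) (hL : L.Nondegenerate)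
    {e e' : ι ⊕ ι} (h : L.IsDouble x e) (h' : L.IsDouble x e') : e = e' ∨ e = e'.swap :=
  AugLCP.eq_or_eq_swap ((hx.existsUnique_doubleLabel hL).unique h.doubleLabel h'.doubleLabel)

/-- Two nodes joined by an edge which leaves the first one by relaxing a constraint of its double
label are joined, from the point of view of the second one, by an edge of the same kind. -/
lemma IsNode.mem_relax_symm [Finite ι] {x x' : (ι → ℝ) × ℝ} (hx : L.IsNode x) (hx' : L.IsNode x')
    (hL : L.Nondegenerate) (hne : x' ≠ x) {e : ι ⊕ ι} (he : L.IsDouble x e)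
    (h : x' ∈ L.relax x e) : ∃ e', L.IsDouble x' e' ∧ x ∈ L.relax x' e' := by
  obtain ⟨i, hi, hiu⟩ := hx'.existsUnique_doubleLabel hL
  have hpos := hx.con_pos h hne
  have hdi : L.IsDouble x' (.inl i) := hi
  -- Outside the double label of `x'`, the constraints tight at `x'` are tight at `x` as well.
  have hkeep : ∀ e₁ : ι ⊕ ι, ¬ L.IsDouble x' e₁ → L.con e₁ x' = 0 → L.con e₁ x = 0 := by
    intro e₁ hnd h1
    by_contra h2
    have h3 := (hx.sol.con_eq_zero_or e₁).resolve_left h2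
    by_cases h4 : e₁.swap = e
    · exact h2 (by rw [← Sum.swap_swap e₁, h4]; exact he.2)
    · exact hnd ⟨h1, h.2 _ h4 h3⟩
  have hdouble : ∀ e₁ : ι ⊕ ι, L.IsDouble x' e₁ → e₁ = .inl i ∨ e₁ = .inr i :=
    fun e₁ h1 => hx'.eq_or_eq_swap hL h1 hdi
  rcases hx.sol.con_eq_zero_or (.inl i) with h0 | h0
  · refine ⟨.inr i, hdi.swap, hx.vertex.1, fun e₁ hne₁ h1 => ?_⟩
    by_cases h2 : L.IsDouble x' e₁
    · rw [(hdouble e₁ h2).resolve_right hne₁, h0]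
    · exact hkeep e₁ h2 h1
  · refine ⟨.inl i, hdi, hx.vertex.1, fun e₁ hne₁ h1 => ?_⟩
    by_cases h2 : L.IsDouble x' e₁
    · rw [(hdouble e₁ h2).resolve_left hne₁]; exact h0
    · exact hkeep e₁ h2 h1

/-- The pivoting rule selects the edge of the double label not used for arriving. -/
lemma IsNode.pivotEdge_eq [Finite ι] {prev cur : (ι → ℝ) × ℝ} (hx : L.IsNode cur)
    (hL : L.Nondegenerate) {e : ι ⊕ ι} (he : L.IsDouble cur e) (hprev : prev ∈ L.relax cur e)
    (hne : prev ≠ cur)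
    {i : ι} (hi : L.DoubleLabel cur i) : L.pivotEdge prev cur i = L.relax cur e.swap := by
  have hii := (hx.existsUnique_doubleLabel hL).unique he.doubleLabel hi
  cases e with
  | inl j =>
    obtain rfl : j = i := hii
    have : L.slack prev j = 0 := hprev.2 (.inr j) (by simp) he.2
    rw [pivotEdge, if_neg (by rw [this]; exact lt_irrefl 0), relaxSlack_eq]; rfl
  | inr j =>
    obtain rfl : j = i := hii
    have : 0 < L.slack prev j := hx.con_pos hprev hne
    rw [pivotEdge, if_pos this, relaxVar_eq]; rfl

lemma finite_nodes [Finite ι] (L : AugLCP ι) : {x | L.IsNode x}.Finite := by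
  refine Set.Finite.of_injOn (f := fun x => {e | L.con e x = 0}) (t := Set.univ)
    (fun _ _ => Set.mem_univ _) (fun x hx x' hx' h => ?_) Set.finite_univ
  exact hx'.eq_of_con_eq_zero fun e he => (Set.ext_iff.1 h e).2 he

/-- The points `x 0, …, x (n + 1)` are visited by the algorithm in this order: `x 0` lies on the
primary ray, `x 1` is its endpoint, and all the points are distinct. -/
structure IsPath (L : AugLCP ι) (n : ℕ) (x : ℕ → (ι → ℝ) × ℝ) : Prop where
  vertex : ∀ t, t ≤ n → L.IsVertex (x (t + 1))
  sol : ∀ t, t ≤ n → L.IsSolution (x (t + 1))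
  pos : ∀ t, t < n → 0 < (x (t + 1)).2
  start_pos : 0 < (x 1).2
  primary : ∀ s : ℝ, 0 ≤ s → x 1 + s • (x 0 - x 1) ∈ L.polyhedron
  edge : ∀ t, t ≤ n → 0 < (x (t + 1)).2 → ∃ e, L.IsDouble (x (t + 1)) e ∧
    x t ∈ L.relax (x (t + 1)) e ∧ (t < n → x (t + 2) ∈ L.relax (x (t + 1)) e.swap)
  inj : ∀ s t, s < t → t ≤ n + 1 → x s ≠ x t

lemma IsPath.isNode {n : ℕ} {x : ℕ → (ι → ℝ) × ℝ} (h : L.IsPath n x) {t : ℕ} (ht : t ≤ n)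
    (hz : 0 < (x (t + 1)).2) : L.IsNode (x (t + 1)) := ⟨h.vertex t ht, h.sol t ht, hz⟩

lemma IsPath.not_isVertex_primary {n : ℕ} {x : ℕ → (ι → ℝ) × ℝ} (h : L.IsPath n x) {s : ℝ}
    (hs : 0 < s) : ¬ L.IsVertex (x 1 + s • (x 0 - x 1)) :=
  not_isVertex_of_mid (h.vertex 0 (Nat.zero_le _)).1 hs (lt_add_one s)
    (sub_ne_zero.2 (h.inj 0 1 one_pos (Nat.le_add_left 1 n))) (h.primary _ (by linarith))

lemma IsPath.ne_next [Finite ι] {n : ℕ} {x : ℕ → (ι → ℝ) × ℝ} (h : L.IsPath n x)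
    (hL : L.Nondegenerate)
    (hz : 0 < (x (n + 1)).2) {e : ι ⊕ ι} (he : L.IsDouble (x (n + 1)) e)
    (hprev : x n ∈ L.relax (x (n + 1)) e) {next : (ι → ℝ) × ℝ}
    (hnext : next ∈ L.relax (x (n + 1)) e.swap) (hne : next ≠ x (n + 1)) (hv : L.IsVertex next)
    (t : ℕ) (ht : t ≤ n + 1) : x t ≠ next := by
  rintro rfl
  have hcur := h.isNode le_rfl hz
  rcases ht.eq_or_lt with rfl | ht
  · exact hne rfl
  rcases (Nat.le_of_lt_succ ht).eq_or_lt with rfl | ht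
  · exact hne (hcur.eq_of_mem_relax_relax (swap_ne e).symm hprev hnext)
  cases t with
  | zero => exact h.not_isVertex_primary one_pos (by simpa using hv)
  | succ t =>
    have ht' : t ≤ n := by omega
    have hnode := h.isNode ht' (h.pos t (by omega))
    obtain ⟨e₁, he₁, hmem⟩ := hcur.mem_relax_symm hnode hL hne he.swap hnext
    obtain ⟨e₂, he₂, hp, hn⟩ := h.edge t ht' hnode.pos
    have hn := hn (by omega)
    have hcne : x (n + 1) ≠ x (t + 1) := (h.inj _ _ (by omega) le_rfl).symm
    have hcurv := h.vertex n le_rfl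
    rcases hnode.eq_or_eq_swap hL he₁ he₂ with rfl | rfl
    · cases t with
      | zero =>
        -- The edge leading back to `x 1` would be the primary ray.
        obtain ⟨v, hv1, hv⟩ := hnode.exists_dir hL he₁.1
        have e0 := hnode.eq_add_smul hv1 hv hp
        have p0 := hnode.con_pos hp (h.inj 0 1 one_pos (by omega))
        have ec := hnode.eq_add_smul hv1 hv hmem
        have pc := hnode.con_pos hmem hcne
        refine h.not_isVertex_primary (div_pos pc p0) ?_
        have : x 1 + (L.con e₁ (x (n + 1)) / L.con e₁ (x 0)) • (x 0 - x 1) = x (n + 1) := by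
          have h1 : x 0 - x 1 = L.con e₁ (x 0) • v := sub_eq_iff_eq_add'.2 e0
          rw [h1, smul_smul, div_mul_cancel₀ _ p0.ne']
          exact ec.symm
        rw [this]
        exact hcurv
      | succ t =>
        exact h.inj _ _ (by omega) le_rfl (hnode.vertex_unique hL he₁.1 hp hmem
          (h.inj _ _ (by omega) (by omega)) hcne (h.vertex t (by omega)) hcurv)
    · exact h.inj _ _ (by omega) le_rfl (hnode.vertex_unique hL he₁.1 hn hmem
        (h.inj _ _ (by omega) (by omega)).symm hcne (h.vertex _ (by omega)) hcurv)

lemma IsPath.extend [Finite ι] {n : ℕ} {x : ℕ → (ι → ℝ) × ℝ} (h : L.IsPath n x)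
    (hL : L.Nondegenerate)
    (hz : 0 < (x (n + 1)).2) {i : ι} (hi : L.DoubleLabel (x (n + 1)) i) {next : (ι → ℝ) × ℝ}
    (hnext : next ∈ L.pivotEdge (x n) (x (n + 1)) i) (hne : next ≠ x (n + 1))
    (hv : L.IsVertex next) :
    ∃ x', L.IsPath (n + 1) x' ∧ (∀ t, t ≤ n + 1 → x' t = x t) ∧ x' (n + 2) = next := by
  have hcur := h.isNode le_rfl hz
  obtain ⟨e, he, hprev, -⟩ := h.edge n le_rfl hz
  rw [hcur.pivotEdge_eq hL he hprev (h.inj _ _ (Nat.lt_succ_self n) le_rfl) hi] at hnext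
  have hsol : L.IsSolution next := hcur.sol.of_mem_relax he.swap.2 hnext
  set x' : ℕ → (ι → ℝ) × ℝ := fun t => if t ≤ n + 1 then x t else next with hx'
  have hlow : ∀ t, t ≤ n + 1 → x' t = x t := fun t ht => if_pos ht
  have htop : x' (n + 2) = next := if_neg (by omega)
  have hlast : ∀ t, t ≤ n + 1 → ¬ t ≤ n → t = n + 1 := fun t _ _ => by omega
  refine ⟨x', ⟨fun t ht => ?_, fun t ht => ?_, fun t ht => ?_, ?_, ?_, fun t ht htz => ?_,
    fun s t hst ht => ?_⟩, hlow, htop⟩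
  · by_cases h1 : t ≤ n
    · rw [hlow _ (by omega)]; exact h.vertex t h1
    · rw [hlast t ht h1, htop]; exact hv
  · by_cases h1 : t ≤ n
    · rw [hlow _ (by omega)]; exact h.sol t h1
    · rw [hlast t ht h1, htop]; exact hsol
  · rw [hlow _ (by omega)]
    rcases (Nat.le_of_lt_succ ht).eq_or_lt with rfl | h1
    · exact hz
    · exact h.pos t h1
  · rw [hlow _ (by omega)]; exact h.start_pos
  · rw [hlow _ (by omega), hlow _ (by omega)]; exact h.primary
  · by_cases h1 : t ≤ n
    · rw [hlow (t + 1) (by omega)] at htz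
      rw [hlow t (by omega), hlow (t + 1) (by omega)]
      rcases h1.eq_or_lt with rfl | h2
      · exact ⟨e, he, hprev, fun _ => by rw [htop]; exact hnext⟩
      · obtain ⟨e', h3, h4, h5⟩ := h.edge t h1 htz
        exact ⟨e', h3, h4, fun _ => by rw [hlow _ (by omega)]; exact h5 h2⟩
    · obtain rfl := hlast t ht h1
      rw [htop] at htz
      rw [htop, hlow _ le_rfl]
      obtain ⟨e', h3, h4⟩ := hcur.mem_relax_symm ⟨hv, hsol, htz⟩ hL hne he.swap hnext
      exact ⟨e', h3, h4, fun h => absurd h (lt_irrefl _)⟩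
  · by_cases h1 : t ≤ n + 1
    · rw [hlow t h1, hlow s (by omega)]; exact h.inj s t hst h1
    · obtain rfl : t = n + 2 := by omega
      rw [htop, hlow s (by omega)]
      exact h.ne_next hL hz he hprev hnext hne hv s (by omega)

lemma IsPath.le_ncard [Finite ι] {n : ℕ} {x : ℕ → (ι → ℝ) × ℝ} (h : L.IsPath n x) :
    n ≤ {x | L.IsNode x}.ncard := by
  have h1 : ((fun t => x (t + 1)) '' (Finset.range n : Set ℕ)).ncard = n := by
    rw [Set.InjOn.ncard_image, Set.ncard_coe_finset, Finset.card_range]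
    intro s hs t ht hst
    simp only [Finset.coe_range, Set.mem_Iio] at hs ht
    rcases lt_trichotomy s t with h2 | h2 | h2
    · exact absurd hst (h.inj _ _ (by omega) (by omega))
    · exact h2
    · exact absurd hst.symm (h.inj _ _ (by omega) (by omega))
  rw [← h1]
  refine Set.ncard_le_ncard ?_ L.finite_nodes
  rintro _ ⟨t, ht, rfl⟩
  simp only [Finset.coe_range, Set.mem_Iio] at ht
  exact h.isNode ht.le (h.pos t ht)

/-- The algorithm does not revisit a vertex, hence it terminates. -/
lemma IsPath.acc [Finite ι] (hL : L.Nondegenerate) {n : ℕ} {x : ℕ → (ι → ℝ) × ℝ}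
    (h : L.IsPath n x) : Acc (fun s' s => L.Step s s') (.run (x n) (x (n + 1))) := by
  obtain ⟨m, hm⟩ := Nat.le.dest h.le_ncard
  induction m generalizing n x with
  | zero =>
    refine ⟨_, fun s hs => ?_⟩
    cases hs with
    | finish hz => exact ⟨_, fun _ hs => by cases hs⟩
    | pivot hz hi hnext hne hv =>
      obtain ⟨x', hx', -, -⟩ := h.extend hL hz hi hnext hne hv
      have := hx'.le_ncard
      omega
    | ray hz hi hray => exact ⟨_, fun _ hs => by cases hs⟩
  | succ m ih =>
    refine ⟨_, fun s hs => ?_⟩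
    cases hs with
    | finish hz => exact ⟨_, fun _ hs => by cases hs⟩
    | pivot hz hi hnext hne hv =>
      obtain ⟨x', hx', h1, h2⟩ := h.extend hL hz hi hnext hne hv
      have := ih hx' (by omega)
      rwa [h1 _ le_rfl, h2] at this
    | ray hz hi hray => exact ⟨_, fun _ hs => by cases hs⟩

/-- If no node other than points with `y = 0` is the endpoint of a ray of solutions, and these only
in the direction `(0, 1)` of the primary ray, then the pivoting algorithm ends in a vertex that
solves the problem with `z = 0`. -/
theorem terminatesWith [Finite ι] (hL : L.Nondegenerate) {z : ℝ} (hz : 0 < z)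
    (hstart : ∀ i, 0 ≤ L.slack (0, z) i) (hd : ∀ i, 0 ≤ L.d i) {i₀ : ι} (hi₀ : 0 < L.d i₀)
    (htight : L.slack (0, z) i₀ = 0)
    (hray : ∀ x v, L.IsNode x → L.IsRay x v → v ≠ 0 → x.1 = 0 ∧ v.1 = 0) :
    L.TerminatesWith (.run (0, z + 1) (0, z))
      (fun x => L.IsVertex x ∧ L.IsSolution x ∧ x.2 = 0) := by
  have hslack : ∀ (s : ℝ) i, L.slack (0, s) i = L.q i + s * L.d i := by intro s i; simp [slack]
  have hprim : ∀ s : ℝ, 0 ≤ s → ((0, z + s) : (ι → ℝ) × ℝ) ∈ L.polyhedron := fun s hs => by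
    refine ⟨fun i => le_rfl, fun i => ?_, by simp only; linarith⟩
    have h1 := hstart i
    have h2 := mul_nonneg hs (hd i)
    rw [hslack] at h1 ⊢
    linarith
  have hmem : ((0, z) : (ι → ℝ) × ℝ) ∈ L.polyhedron := by simpa using hprim 0 le_rfl
  have hvert : L.IsVertex (0, z) := by
    refine mem_extremePoints.2 ⟨hmem, ?_⟩
    rintro a ha b hb ⟨s, r, hs, hr, hsr, hab⟩
    have hsplit : ∀ f : (ι → ℝ) × ℝ → ℝ, 0 ≤ f a → 0 ≤ f b → s * f a + r * f b = 0 →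
        f a = 0 ∧ f b = 0 := fun f h1 h2 h3 => by
      have h1' := mul_nonneg hs.le h1
      have h2' := mul_nonneg hr.le h2
      exact ⟨(mul_eq_zero.1 (by linarith)).resolve_left hs.ne',
        (mul_eq_zero.1 (by linarith)).resolve_left hr.ne'⟩
    have hy : ∀ i, a.1 i = 0 ∧ b.1 i = 0 := fun i =>
      hsplit (fun x => x.1 i) (ha.1 i) (hb.1 i) (by simpa using congrFun (congrArg Prod.fst hab) i)
    have ha1 : a.1 = 0 := funext fun i => (hy i).1
    have hb1 : b.1 = 0 := funext fun i => (hy i).2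
    have hzz : s * a.2 + r * b.2 = z := by simpa using congrArg Prod.snd hab
    have hsl := hsplit (fun x => L.slack x i₀) (ha.2.1 i₀) (hb.2.1 i₀) (by
      rw [hslack] at htight
      simp only [slack, ha1, hb1, map_zero, Pi.zero_apply]
      linear_combination htight + L.q i₀ * hsr + L.d i₀ * hzz)
    have hval : ∀ x : (ι → ℝ) × ℝ, x.1 = 0 → L.slack x i₀ = 0 → x = (0, z) := by
      rintro ⟨y, s⟩ rfl h
      rw [hslack] at h htight
      have : s = z := mul_right_cancel₀ hi₀.ne' (by linarith)
      rw [this]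
    exact ⟨hval a ha1 hsl.1, hval b hb1 hsl.2⟩
  have hsol : L.IsSolution (0, z) := ⟨hmem, fun i => by simp⟩
  have hnode₀ : L.IsNode (0, z) := ⟨hvert, hsol, hz⟩
  have hd₀ : L.IsDouble (0, z) (.inr i₀) := ⟨htight, rfl⟩
  have hp₀ : ((0, z + 1) : (ι → ℝ) × ℝ) ∈ L.relax (0, z) (.inr i₀) := by
    refine ⟨hprim 1 zero_le_one, fun e hne he => ?_⟩
    cases e with
    | inl i => rfl
    | inr i =>
      have := (hnode₀.existsUnique_doubleLabel hL).unique (y₁ := i) ⟨rfl, he⟩ hd₀.doubleLabel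
      exact absurd (congrArg Sum.inr this) hne
  -- A node with `y = 0` is the endpoint of the primary ray.
  have huniq : ∀ x, L.IsNode x → x.1 = 0 → x = (0, z) := by
    rintro ⟨y, s⟩ hx rfl
    by_contra hne
    have h1 : z ≤ s := by
      have := hx.sol.1.2.1 i₀
      rw [hslack] at this htight
      nlinarith
    have h2 : z < s := h1.lt_of_ne fun h => hne (by rw [h])
    have h3 := not_isVertex_of_mid (L := L) (x := (0, z)) (v := (0, 1)) (s := s - z)
      (t := s - z + 1) hmem (by linarith) (by linarith) (by simp)
      (by simpa using hprim (s - z + 1) (by linarith))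
    simp only [Prod.smul_mk, smul_zero, smul_eq_mul, mul_one, Prod.mk_add_mk, add_zero,
      add_sub_cancel] at h3
    exact h3 hx.vertex
  have hpath : ∃ x, L.IsPath 0 x ∧ x 0 = (0, z + 1) ∧ x 1 = (0, z) := by
    refine ⟨fun t => if t = 0 then (0, z + 1) else (0, z), ⟨fun t _ => by simpa using hvert,
      fun t _ => by simpa using hsol, fun t ht => absurd ht (Nat.not_lt_zero t), by simpa using hz,
      fun s hs => ?_, fun t ht _ => ?_, fun s t hst ht => ?_⟩, rfl, rfl⟩
    · simpa using hprim s hs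
    · obtain rfl : t = 0 := by omega
      exact ⟨_, hd₀, hp₀, fun h => absurd h (lt_irrefl _)⟩
    · obtain rfl : t = 1 := by omega
      obtain rfl : s = 0 := by omega
      simp
  obtain ⟨x₀, hx₀, h00, h01⟩ := hpath
  refine ⟨by rw [← h00, ← h01]; exact hx₀.acc hL, ?_⟩
  have hinv : ∀ s, Relation.ReflTransGen L.Step (.run (0, z + 1) (0, z)) s →
      (∃ n x, L.IsPath n x ∧ x 0 = (0, z + 1) ∧ x 1 = (0, z) ∧ s = .run (x n) (x (n + 1))) ∨
      ∃ x, s = .output x ∧ L.IsVertex x ∧ L.IsSolution x ∧ x.2 = 0 := by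
    intro s hs
    induction hs with
    | refl => exact .inl ⟨0, x₀, hx₀, h00, h01, by rw [h00, h01]⟩
    | tail _ hstep ih =>
      rcases ih with ⟨n, x, hx, hx0, hx1, rfl⟩ | ⟨x, rfl, -⟩
      · cases hstep with
        | finish hz => exact .inr ⟨_, rfl, hx.vertex n le_rfl, hx.sol n le_rfl, hz⟩
        | pivot hz hi hnext hne hv =>
          obtain ⟨x', hx', h1, h2⟩ := hx.extend hL hz hi hnext hne hv
          exact .inl ⟨n + 1, x', hx', (h1 0 (by omega)).trans hx0, (h1 1 (by omega)).trans hx1,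
            by rw [h1 _ le_rfl, h2]⟩
        | ray hz hi hnone =>
          exfalso
          have hcur := hx.isNode le_rfl hz
          obtain ⟨e, he, hprev, -⟩ := hx.edge n le_rfl hz
          have hpne := hx.inj _ _ (Nat.lt_succ_self n) le_rfl
          rw [hcur.pivotEdge_eq hL he hprev hpne hi] at hnone
          rcases hcur.exists_vertex_or_ray hL he.2 with ⟨x', h1, h2, h3⟩ | ⟨v, hv1, hv, hvray⟩
          · exact h2 (hnone x' h1 h3)
          have hv0 : v ≠ 0 := by rintro rfl; simp at hv1
          obtain ⟨hy, hv10⟩ := hray _ v hcur (hcur.sol.isRay he.swap.2 hv hvray) hv0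
          have hc : x (n + 1) = (0, z) := huniq _ hcur hy
          obtain rfl : n = 0 := by
            by_contra hn
            exact hx.inj 1 (n + 1) (by omega) le_rfl (hx1.trans hc.symm)
          -- The first edge relaxes a variable, which therefore grows along it.
          cases e with
          | inl j =>
            have := hcur.con_pos hprev hpne
            rw [hx0] at this
            exact lt_irrefl _ this
          | inr j =>
            have : v.1 j = 1 := hv1
            rw [hv10] at this
            exact zero_ne_one this
      · cases hstep
  intro s hs hend
  rcases hinv s hs with ⟨n, x, hx, -, -, rfl⟩ | ⟨x, h1, h2⟩
  · exfalso
    rcases (hx.sol n le_rfl).1.2.2.eq_or_lt with h0 | hpos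
    · exact hend _ (.finish h0.symm)
    · obtain ⟨i, hi, -⟩ := (hx.isNode le_rfl hpos).existsUnique_doubleLabel hL
      by_cases hex : ∃ next ∈ L.pivotEdge (x n) (x (n + 1)) i, L.IsVertex next ∧ next ≠ x (n + 1)
      · obtain ⟨next, h1, h2, h3⟩ := hex
        exact hend _ (.pivot hpos hi h1 h3 h2)
      · push Not at hex
        exact hend _ (.ray hpos hi hex)
  · exact ⟨x, h1, h2⟩

end AugLCP

namespace AugLCP

variable {ι : Type*} {L : AugLCP ι}

lemma TerminatesWith.exists_output {s₀ : PivotConfig ι} {Q : (ι → ℝ) × ℝ → Prop}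
    (h : L.TerminatesWith s₀ Q) : ∃ x, Q x := by
  obtain ⟨hacc, hend⟩ := h
  induction hacc with
  | intro s _ ih =>
    by_cases hs : ∃ s', L.Step s s'
    · obtain ⟨s', hs'⟩ := hs
      exact ih s' hs' fun t ht => hend t (.head hs' ht)
    · push Not at hs
      obtain ⟨x, -, hx⟩ := hend s .refl hs
      exact ⟨x, hx⟩

lemma TerminatesWith.mono {s₀ : PivotConfig ι} {Q Q' : (ι → ℝ) × ℝ → Prop}
    (h : L.TerminatesWith s₀ Q) (hQ : ∀ x, Q x → Q' x) : L.TerminatesWith s₀ Q' :=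
  ⟨h.1, fun s hs hend => (h.2 s hs hend).imp fun x hx => ⟨hx.1, hQ x hx.2⟩⟩

/-! ### Perturbation of the right-hand sides -/

/-- The problem with the right-hand sides replaced by `q`. -/
def withRhs (L : AugLCP ι) (q : ι → ℝ) : AugLCP ι := ⟨L.M, q, L.d⟩

lemma slack_eq (L : AugLCP ι) (x : (ι → ℝ) × ℝ) (i : ι) :
    L.slack x i = L.q i + L.lin (.inr i) x := by
  rw [lin_inr, slack]; ring

lemma slack_withRhs (q : ι → ℝ) (x : (ι → ℝ) × ℝ) (i : ι) :
    (L.withRhs q).slack x i = q i + L.lin (.inr i) x := slack_eq _ x i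

lemma lin_withRhs (q : ι → ℝ) (e : ι ⊕ ι) : (L.withRhs q).lin e = L.lin e := by
  cases e <;> rfl

lemma continuous_lin [Finite ι] (e : ι ⊕ ι) : Continuous (L.lin e) :=
  (L.lin e).continuous_of_finiteDimensional

/-- The vertices are bounded in terms of the right-hand sides: each is the solution of one of
finitely many injective linear systems. -/
lemma exists_norm_vertex_le [Fintype ι] (L : AugLCP ι) :
    ∃ K : ℝ, 0 ≤ K ∧ ∀ q x, (L.withRhs q).IsVertex x → ‖x‖ ≤ K * ‖q‖ := by
  classical
  let Φ : Set (Option (ι ⊕ ι)) → ((ι → ℝ) × ℝ →ₗ[ℝ] (Option (ι ⊕ ι) → ℝ)) := fun T =>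
    LinearMap.pi fun o => if o ∈ T then o.elim (LinearMap.snd ℝ _ _) L.lin else 0
  have hΦ : ∀ T, ∃ K : ℝ, (LinearMap.ker (Φ T) = ⊥ → ∀ x, ‖x‖ ≤ K * ‖Φ T x‖) := by
    intro T
    by_cases h : LinearMap.ker (Φ T) = ⊥
    · obtain ⟨K, -, hK⟩ := (Φ T).exists_antilipschitzWith h
      refine ⟨K, fun _ x => ?_⟩
      simpa using hK.le_mul_dist x 0
    · exact ⟨0, fun h' => absurd h' h⟩
  choose K hK using hΦ
  obtain ⟨B, hB⟩ := Finite.exists_le K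
  refine ⟨max B 0, le_max_right _ _, fun q x hx => ?_⟩
  set T : Set (Option (ι ⊕ ι)) :=
    {o | o.elim (x.2 = 0) fun e => (L.withRhs q).con e x = 0} with hT
  have hker : LinearMap.ker (Φ T) = ⊥ := by
    rw [LinearMap.ker_eq_bot']
    intro v hv
    refine hx.eq_zero_of_lin_eq_zero (fun e he => ?_) fun hz => ?_
    · have := congrFun hv (some e)
      have hmem : some e ∈ T := he
      simpa [Φ, hmem, lin_withRhs] using this
    · have := congrFun hv none
      have hmem : none ∈ T := hz
      simpa [Φ, hmem] using this
  have hle : ‖Φ T x‖ ≤ ‖q‖ := by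
    refine (pi_norm_le_iff_of_nonneg (norm_nonneg _)).2 fun o => ?_
    by_cases ho : o ∈ T
    · rcases o with _ | (i | i)
      · have hz : x.2 = 0 := ho
        simp [Φ, ho, hz]
      · have hi : x.1 i = 0 := ho
        simp [Φ, ho, hi]
      · have hi : (L.withRhs q).slack x i = 0 := ho
        rw [slack_withRhs] at hi
        have : Φ T x (some (.inr i)) = - q i := by simp [Φ, ho]; linarith
        rw [this, norm_neg]
        exact norm_le_pi_norm q i
    · simp [Φ, ho]
  calc ‖x‖ ≤ K T * ‖Φ T x‖ := hK T hker x
    _ ≤ max B 0 * ‖Φ T x‖ := by gcongr; exact (hB T).trans (le_max_left _ _)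
    _ ≤ max B 0 * ‖q‖ := by gcongr

/-- Too many constraints can be tight simultaneously only for special right-hand sides. -/
lemma exists_functional [Fintype ι] (L : AugLCP ι) (T : Set (ι ⊕ ι))
    (hT : Nat.card ι + 1 < Nat.card T) :
    ∃ ψ : (ι → ℝ) →ₗ[ℝ] ℝ, ψ ≠ 0 ∧
      ∀ q x, (∀ e ∈ T, (L.withRhs q).con e x = 0) → ψ q = 0 := by
  classical
  have hdep : ¬ LinearIndependent ℝ fun e : T => (L.lin e.1 : Module.Dual ℝ ((ι → ℝ) × ℝ)) := by
    intro h
    have := h.fintype_card_le_finrank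
    rw [Subspace.dual_finrank_eq, finrank_prod_real, ← Nat.card_eq_fintype_card] at this
    omega
  obtain ⟨φ, hφ, e₀, he₀⟩ := Fintype.not_linearIndependent_iff.1 hdep
  let c : ι ⊕ ι → ((ι → ℝ) →ₗ[ℝ] ℝ) := Sum.elim (fun _ => 0) LinearMap.proj
  have hrel : ∀ x, ∑ e : T, φ e * L.lin e.1 x = 0 := fun x => by
    simpa using LinearMap.congr_fun hφ x
  have hcon : ∀ q e x, (L.withRhs q).con e x = c e q + L.lin e x := by
    intro q e x
    cases e with
    | inl i => simp [con, c]
    | inr i => exact slack_withRhs q x i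
  refine ⟨∑ e : T, φ e • c e.1, fun h0 => he₀ ?_, fun q x hx => ?_⟩
  · have hinr : ∀ i (hi : Sum.inr i ∈ T), φ ⟨_, hi⟩ = 0 := by
      intro i hi
      have := LinearMap.congr_fun h0 (Pi.single i 1)
      rw [LinearMap.sum_apply, Finset.sum_eq_single ⟨_, hi⟩] at this
      · simpa [c] using this
      · rintro ⟨e, he⟩ - hne
        cases e with
        | inl j => simp [c]
        | inr j =>
          have : j ≠ i := by rintro rfl; exact hne rfl
          simp [c, this]
      · simp
    have hinl : ∀ i (hi : Sum.inl i ∈ T), φ ⟨_, hi⟩ = 0 := by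
      intro i hi
      have := hrel (Pi.single i 1, 0)
      rw [Finset.sum_eq_single ⟨_, hi⟩] at this
      · simpa using this
      · rintro ⟨e, he⟩ - hne
        cases e with
        | inl j =>
          have : j ≠ i := by rintro rfl; exact hne rfl
          simp [this]
        | inr j => rw [hinr j he, zero_mul]
      · simp
    obtain ⟨e | e, he⟩ := e₀
    · exact hinl e he
    · exact hinr e he
  · have h1 : ∀ e : T, c e.1 q = - L.lin e.1 x := fun e => by
      have := hcon q e.1 x
      rw [hx e.1 e.2] at this
      linarith
    simp [h1, hrel]

/-- The problem is non-degenerate for generic right-hand sides. -/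
lemma dense_nondegenerate [Fintype ι] (L : AugLCP ι) :
    Dense {q | (L.withRhs q).Nondegenerate} := by
  have h : ∀ T : {T : Set (ι ⊕ ι) // Nat.card ι + 1 < Nat.card T}, ∃ ψ : (ι → ℝ) →ₗ[ℝ] ℝ,
      ψ ≠ 0 ∧ ∀ q x, (∀ e ∈ T.1, (L.withRhs q).con e x = 0) → ψ q = 0 :=
    fun T => L.exists_functional T.1 T.2
  choose ψ hψ0 hψ using h
  have hopen : ∀ T, IsOpen {q | ψ T q ≠ 0} := fun T =>
    isOpen_ne_fun (ψ T).continuous_of_finiteDimensional continuous_const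
  have hdense : ∀ T, Dense {q | ψ T q ≠ 0} := fun T => by
    have : {q | ψ T q ≠ 0} = ((LinearMap.ker (ψ T) : Set (ι → ℝ)))ᶜ := by ext; simp
    rw [this, ← interior_eq_empty_iff_dense_compl, ← Set.not_nonempty_iff_eq_empty]
    intro hne
    exact hψ0 T (LinearMap.ker_eq_top.1 (Submodule.eq_top_of_nonempty_interior' _ hne))
  refine (dense_iInter_of_isOpen hopen hdense).mono fun q hq x hv hs hz => ?_
  rw [← card_tight]
  refine le_antisymm ?_ ?_
  · by_contra hlt
    push Not at hlt
    exact Set.mem_iInter.1 hq ⟨{e | (L.withRhs q).con e x = 0}, hlt⟩ (hψ _ q x fun e he => he)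
  · classical
    have := LinearMap.finrank_le_finrank_of_injective (hv.tightMap_injective hz)
    rwa [finrank_prod_real, Module.finrank_pi, ← Nat.card_eq_fintype_card] at this

section Limits

variable {p : ℕ → ι → ℝ} {q : ι → ℝ} {x v : ℕ → (ι → ℝ) × ℝ} {x' v' : (ι → ℝ) × ℝ}

lemma tendsto_fst_apply (hx : Tendsto x atTop (𝓝 x')) (i : ι) :
    Tendsto (fun n => (x n).1 i) atTop (𝓝 (x'.1 i)) :=
  tendsto_pi_nhds.1 hx.fst_nhds i

lemma tendsto_slack [Finite ι] (hp : Tendsto p atTop (𝓝 q)) (hx : Tendsto x atTop (𝓝 x')) (i : ι) :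
    Tendsto (fun n => (L.withRhs (p n)).slack (x n) i) atTop (𝓝 ((L.withRhs q).slack x' i)) := by
  simp only [slack_withRhs]
  exact (tendsto_pi_nhds.1 hp i).add (((continuous_lin _).tendsto _).comp hx)

lemma isSolution_of_tendsto [Finite ι] (hp : Tendsto p atTop (𝓝 q)) (hx : Tendsto x atTop (𝓝 x'))
    (h : ∀ n, (L.withRhs (p n)).IsSolution (x n)) : (L.withRhs q).IsSolution x' := by
  refine ⟨⟨fun i => ?_, fun i => ?_, ?_⟩, fun i => ?_⟩
  · exact ge_of_tendsto' (tendsto_fst_apply hx i) fun n => (h n).1.1 i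
  · exact ge_of_tendsto' (tendsto_slack hp hx i) fun n => (h n).1.2.1 i
  · exact ge_of_tendsto' hx.snd_nhds fun n => (h n).1.2.2
  · exact tendsto_nhds_unique ((tendsto_fst_apply hx i).mul (tendsto_slack hp hx i))
      (by simp [(h _).2 i])

lemma isRay_of_tendsto [Finite ι] (hp : Tendsto p atTop (𝓝 q)) (hx : Tendsto x atTop (𝓝 x'))
    (hv : Tendsto v atTop (𝓝 v')) (h : ∀ n, (L.withRhs (p n)).IsRay (x n) (v n)) :
    (L.withRhs q).IsRay x' v' := by
  have hlin : ∀ i, Tendsto (fun n => L.lin (.inr i) (v n)) atTop (𝓝 (L.lin (.inr i) v')) :=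
    fun i => ((continuous_lin _).tendsto _).comp hv
  refine ⟨fun i => ?_, fun i => ?_, ?_, fun i => ?_, fun i => ?_, fun i => ?_⟩
  · exact ge_of_tendsto' (tendsto_fst_apply hv i) fun n => (h n).nonneg i
  · exact ge_of_tendsto' (hlin i) fun n => (h n).lin_nonneg i
  · exact ge_of_tendsto' hv.snd_nhds fun n => (h n).z_nonneg
  · exact tendsto_nhds_unique ((tendsto_fst_apply hx i).mul (hlin i))
      (by
        simp only [fun n => by simpa only [lin_withRhs] using (h n).mul_lin i,
          tendsto_const_nhds])
  · exact tendsto_nhds_unique ((tendsto_fst_apply hv i).mul (tendsto_slack hp hx i))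
      (by simp [(h _).mul_slack i])
  · exact tendsto_nhds_unique ((tendsto_fst_apply hv i).mul (hlin i))
      (by
        simp only [fun n => by simpa only [lin_withRhs] using (h n).mul_self i,
          tendsto_const_nhds])

end Limits

lemma IsRay.smul {x v : (ι → ℝ) × ℝ} (h : L.IsRay x v) {s : ℝ} (hs : 0 ≤ s) :
    L.IsRay x (s • v) := by
  refine ⟨fun i => mul_nonneg hs (h.nonneg i), fun i => ?_, mul_nonneg hs h.z_nonneg,
    fun i => ?_, fun i => ?_, fun i => ?_⟩
  · rw [map_smul]; exact mul_nonneg hs (h.lin_nonneg i)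
  · rw [map_smul, smul_eq_mul, mul_left_comm, h.mul_lin, mul_zero]
  · rw [Prod.smul_fst, Pi.smul_apply, smul_eq_mul, mul_assoc, h.mul_slack, mul_zero]
  · rw [map_smul, Prod.smul_fst, Pi.smul_apply, smul_eq_mul, smul_eq_mul, mul_mul_mul_comm,
      h.mul_self, mul_zero]

/-- The endpoint of the primary ray. -/
lemma exists_start [Finite ι] (hd : ∀ i, 0 ≤ L.d i) (hq : ∀ i, L.d i = 0 → 0 < L.q i)
    (hneg : ∃ i, 0 < L.d i ∧ L.q i < 0) :
    ∃ z, 0 < z ∧ (∀ i, 0 ≤ L.slack (0, z) i) ∧ ∃ i, 0 < L.d i ∧ L.slack (0, z) i = 0 := by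
  have hslack : ∀ (s : ℝ) i, L.slack (0, s) i = L.q i + s * L.d i := by intro s i; simp [slack]
  obtain ⟨i₁, hd₁, hq₁⟩ := hneg
  obtain ⟨i₀, hi₀, hmax⟩ := Set.exists_max_image {i | 0 < L.d i} (fun i => - L.q i / L.d i)
    (Set.toFinite _) ⟨i₁, hd₁⟩
  refine ⟨- L.q i₀ / L.d i₀, lt_of_lt_of_le (div_pos (by linarith) hd₁) (hmax i₁ hd₁),
    fun i => ?_, i₀, hi₀, ?_⟩
  · rw [hslack]
    rcases (hd i).eq_or_lt with h | h
    · rw [← h, mul_zero, add_zero]; exact (hq i h.symm).le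
    · have := (div_le_iff₀ h).1 (hmax i h)
      linarith
  · rw [hslack, div_mul_cancel₀ _ (ne_of_gt hi₀)]; ring

/-- The problem has a solution with `z = 0` if, for all right-hand sides in a set `U` accumulating
at those of the problem, the pivoting algorithm cannot end in a secondary ray. By compactness it
suffices to consider limits of such rays. -/
theorem exists_isSolution [Fintype ι] (hd : ∀ i, 0 ≤ L.d i)
    (hq : ∀ i, L.d i = 0 → 0 < L.q i) (hneg : ∃ i, 0 < L.d i ∧ L.q i < 0) {U : Set (ι → ℝ)}
    (hU : IsOpen U) (hUq : L.q ∈ closure U)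
    (hray : ∀ (p : ℕ → ι → ℝ) (x v : ℕ → (ι → ℝ) × ℝ) (x' v' : (ι → ℝ) × ℝ), (∀ n, p n ∈ U) →
      (∀ n, (L.withRhs (p n)).IsNode (x n)) → (∀ n, (L.withRhs (p n)).IsRay (x n) (v n)) →
      Tendsto x atTop (𝓝 x') → Tendsto v atTop (𝓝 v') → L.IsSolution x' → L.IsRay x' v' → v' ≠ 0 →
      x'.1 = 0 ∧ v'.1 = 0) :
    ∃ x, L.IsSolution x ∧ x.2 = 0 := by
  have hcl : L.q ∈ closure (U ∩ {q | (L.withRhs q).Nondegenerate}) :=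
    closure_minimal (L.dense_nondegenerate.open_subset_closure_inter hU) isClosed_closure hUq
  obtain ⟨p, hpU, hp⟩ := mem_closure_iff_seq_limit.1 hcl
  obtain ⟨K, hK0, hK⟩ := L.exists_norm_vertex_le
  obtain ⟨B, hB⟩ := hp.norm.bddAbove_range
  have hbdd : ∀ n x, (L.withRhs (p n)).IsVertex x → x ∈ Metric.closedBall 0 (K * B) := by
    intro n x hx
    rw [mem_closedBall_zero_iff]
    exact (hK _ _ hx).trans (mul_le_mul_of_nonneg_left (hB ⟨n, rfl⟩) hK0)
  -- Secondary rays do not occur close to the given right-hand sides.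
  have hgood : ∀ᶠ n in atTop, ∀ x v, (L.withRhs (p n)).IsNode x → (L.withRhs (p n)).IsRay x v →
      v ≠ 0 → x.1 = 0 ∧ v.1 = 0 := by
    by_contra hbad
    obtain ⟨φ, hφ, hbad⟩ := extraction_of_frequently_atTop (not_eventually.1 hbad)
    push Not at hbad
    choose x v hx hv hv0 hne using hbad
    have hw : ∀ n, ‖v n‖⁻¹ • v n ∈ Metric.sphere (0 : (ι → ℝ) × ℝ) 1 := fun n => by
      rw [mem_sphere_zero_iff_norm, norm_smul, norm_inv, norm_norm,
        inv_mul_cancel₀ (norm_ne_zero_iff.2 (hv0 n))]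
    obtain ⟨⟨x', v'⟩, hmem, χ, hχ, hlim⟩ := tendsto_subseq_of_bounded
      (Metric.isBounded_closedBall.prod Metric.isBounded_sphere)
      (x := fun n => (x n, ‖v n‖⁻¹ • v n)) fun n => Set.mk_mem_prod (hbdd _ _ (hx n).vertex) (hw n)
    have hx' : Tendsto (fun n => x (χ n)) atTop (𝓝 x') := hlim.fst_nhds
    have hv' : Tendsto (fun n => ‖v (χ n)‖⁻¹ • v (χ n)) atTop (𝓝 v') := hlim.snd_nhds
    have hv1 : ‖v'‖ = 1 := tendsto_nhds_unique hv'.norm (by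
      simp only [fun n => mem_sphere_zero_iff_norm.1 (hw n)]
      exact tendsto_const_nhds)
    have hp' : Tendsto (fun n => p (φ (χ n))) atTop (𝓝 L.q) :=
      hp.comp (hφ.tendsto_atTop.comp hχ.tendsto_atTop)
    have hrays : ∀ n, (L.withRhs (p (φ (χ n)))).IsRay (x (χ n)) (‖v (χ n)‖⁻¹ • v (χ n)) :=
      fun n => (hv (χ n)).smul (inv_nonneg.2 (norm_nonneg _))
    have hv'0 : v' ≠ 0 := norm_ne_zero_iff.1 (by rw [hv1]; exact one_ne_zero)
    obtain ⟨h1, h2⟩ := hray (fun n => p (φ (χ n))) (fun n => x (χ n)) _ x' v'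
      (fun n => (hpU _).1) (fun n => hx (χ n)) hrays hx' hv'
      (isSolution_of_tendsto hp' hx' fun n => (hx (χ n)).sol)
      (isRay_of_tendsto hp' hx' hv' hrays) hv'0
    have hz : 0 < v'.2 := by
      refine (ge_of_tendsto' hv'.snd_nhds fun n => (hrays n).z_nonneg).lt_of_ne fun h => hv'0 ?_
      exact Prod.ext h2 h.symm
    have hev : ∀ i, ∀ᶠ n in atTop, (x (χ n)).1 i = 0 ∧ (v (χ n)).1 i = 0 := by
      intro i
      have hinv : ∀ n, ‖v (χ n)‖⁻¹ ≠ 0 := fun n => inv_ne_zero (norm_ne_zero_iff.2 (hv0 _))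
      rcases (hd i).eq_or_lt with h | h
      · have hpos : 0 < (L.withRhs L.q).slack x' i := by
          rw [slack_withRhs, lin_inr, h1, ← h]
          simpa using hq i h.symm
        filter_upwards [(tendsto_slack hp' hx' i).eventually_const_lt hpos] with n hn
        refine ⟨(mul_eq_zero.1 ((hx (χ n)).sol.2 i)).resolve_right hn.ne', ?_⟩
        exact (mul_eq_zero.1 ((hv (χ n)).mul_slack i)).resolve_right hn.ne'
      · have hpos : 0 < L.lin (.inr i) v' := by
          rw [lin_inr, h2]
          simpa using mul_pos hz h
        have ht : Tendsto (fun n => L.lin (.inr i) (‖v (χ n)‖⁻¹ • v (χ n))) atTop _ :=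
          ((continuous_lin (L := L) (.inr i)).tendsto _).comp hv'
        filter_upwards [ht.eventually_const_lt hpos] with n hn
        have e1 := (hrays n).mul_lin i
        have e2 := (hrays n).mul_self i
        rw [lin_withRhs] at e1 e2
        refine ⟨(mul_eq_zero.1 e1).resolve_right hn.ne', ?_⟩
        exact (mul_eq_zero.1 ((mul_eq_zero.1 e2).resolve_right hn.ne')).resolve_left (hinv n)
    obtain ⟨n, hn⟩ := (eventually_all.2 hev).exists
    exact hne (χ n) (funext fun i => (hn i).1) (funext fun i => (hn i).2)
  have hqpos : ∀ᶠ n in atTop, ∀ i, L.d i = 0 → 0 < p n i := by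
    refine eventually_all.2 fun i => ?_
    by_cases h : L.d i = 0
    · exact ((tendsto_pi_nhds.1 hp i).eventually_const_lt (hq i h)).mono fun _ hn _ => hn
    · exact Eventually.of_forall fun _ h' => absurd h' h
  obtain ⟨i₁, hd₁, hq₁⟩ := hneg
  have hqneg := (tendsto_pi_nhds.1 hp i₁).eventually_lt_const hq₁
  have hsol : ∀ᶠ n in atTop, ∃ x, (L.withRhs (p n)).IsVertex x ∧ (L.withRhs (p n)).IsSolution x ∧
      x.2 = 0 := by
    filter_upwards [hgood, hqpos, hqneg] with n h1 h2 h3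
    obtain ⟨z, hz, hs, i₀, hi₀, ht⟩ := exists_start (L := L.withRhs (p n)) hd h2 ⟨i₁, hd₁, h3⟩
    exact (terminatesWith (hpU n).2 hz hs hd hi₀ ht h1).exists_output
  obtain ⟨φ, hφ, hsol⟩ := extraction_of_eventually_atTop hsol
  choose x hx hxs hxz using hsol
  obtain ⟨x', -, χ, hχ, hlim⟩ := tendsto_subseq_of_bounded Metric.isBounded_closedBall
    fun n => hbdd _ _ (hx n)
  exact ⟨x', isSolution_of_tendsto (hp.comp (hφ.tendsto_atTop.comp hχ.tendsto_atTop)) hlim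
    fun n => hxs _, tendsto_nhds_unique hlim.snd_nhds (by simp [hxz])⟩

end AugLCP

/-! ### Optimal use of the segments of a piecewise-linear concave function -/

namespace PLC

variable (P : PLC)

lemma lenTrunc_castSucc (B : ℝ) (k : Fin P.m) : P.lenTrunc B k.castSucc = P.len k := by
  simp [lenTrunc]

lemma lenTrunc_last (B : ℝ) : P.lenTrunc B (Fin.last P.m) = B := by simp [lenTrunc]

lemma lenTrunc_pos {B : ℝ} (hB : 0 < B) (k : Fin (P.m + 1)) : 0 < P.lenTrunc B k := by
  induction k using Fin.lastCases with
  | last => rwa [lenTrunc_last]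
  | cast k => rw [lenTrunc_castSucc]; exact P.len_pos k

lemma start_zero : P.start 0 = 0 := by simp [start]

lemma start_succ (k : Fin P.m) : P.start k.succ = P.start k.castSucc + P.len k := by
  have : Finset.univ.filter (fun k' : Fin P.m => k'.castSucc < k.succ) =
      insert k (Finset.univ.filter fun k' : Fin P.m => k'.castSucc < k.castSucc) := by
    ext k'
    simp only [Finset.mem_filter, Finset.mem_univ, true_and, Finset.mem_insert, Fin.lt_def,
      Fin.val_castSucc, Fin.val_succ, Fin.ext_iff]
    omega
  rw [start, this, Finset.sum_insert (by simp), start, add_comm]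

lemma start_mono : Monotone P.start := fun _ _ h =>
  Finset.sum_le_sum_of_subset_of_nonneg
    (Finset.monotone_filter_right _ fun _ _ hk => lt_of_lt_of_le hk h)
    fun k _ _ => (P.len_pos k).le

/-- The lengths of the parts of `[0, x]` that lie in the domains of the segments. -/
noncomputable def seg (x : ℝ) : Fin (P.m + 1) → ℝ :=
  Fin.snoc (α := fun _ => ℝ) (fun k => min (P.len k) (max 0 (x - P.start k.castSucc)))
    (max 0 (x - P.start (Fin.last P.m)))

lemma seg_castSucc (x : ℝ) (k : Fin P.m) :
    P.seg x k.castSucc = min (P.len k) (max 0 (x - P.start k.castSucc)) := by simp [seg]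

lemma seg_last (x : ℝ) : P.seg x (Fin.last P.m) = max 0 (x - P.start (Fin.last P.m)) := by
  simp [seg]

lemma eval_eq_sum (x : ℝ) : P.eval x = ∑ k, P.slope k * P.seg x k := by
  rw [Fin.sum_univ_castSucc, eval, seg_last]
  simp only [seg_castSucc]

lemma sum_seg {x : ℝ} (hx : 0 ≤ x) : ∑ k, P.seg x k = x := by
  have h1 : ∀ k : Fin P.m,
      P.seg x k.castSucc = min x (P.start k.succ) - min x (P.start k.castSucc) := by
    intro k
    rw [seg_castSucc, start_succ]
    have := P.len_pos k
    rcases le_total x (P.start k.castSucc) with h | h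
    · rw [max_eq_left (by linarith), min_eq_left h, min_eq_left (b := _ + _) (by linarith),
        min_eq_right this.le, sub_self]
    · rw [min_eq_right h, max_eq_right (by linarith)]
      rcases le_total x (P.start k.castSucc + P.len k) with h' | h'
      · rw [min_eq_left h', min_eq_right (by linarith)]
      · rw [min_eq_right h', min_eq_left (by linarith)]; ring
  have h2 := Fin.sum_univ_castSucc fun k => min x (P.start k)
  have h3 := Fin.sum_univ_succ fun k => min x (P.start k)
  rw [start_zero, min_eq_right hx] at h3
  rw [Fin.sum_univ_castSucc, Finset.sum_congr rfl fun k _ => h1 k, Finset.sum_sub_distrib, seg_last]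
  rcases le_total x (P.start (Fin.last P.m)) with h | h
  · rw [max_eq_left (by linarith)]; rw [min_eq_left h] at h2; linarith
  · rw [max_eq_right (by linarith)]; rw [min_eq_right h] at h2; linarith

/-- A distribution of some amount over the segments that respects their lengths. -/
structure IsFill (a : Fin (P.m + 1) → ℝ) : Prop where
  nonneg : ∀ k, 0 ≤ a k
  le_len : ∀ k : Fin P.m, a k.castSucc ≤ P.len k

/-- The segments with slope larger than the price `π` are filled and those with smaller slope are
empty. -/
structure IsOptimalFill (π : ℝ) (a : Fin (P.m + 1) → ℝ) : Prop extends P.IsFill a where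
  full : ∀ k : Fin P.m, π < P.slope k.castSucc → a k.castSucc = P.len k
  last : P.slope (Fin.last P.m) ≤ π
  empty : ∀ k, P.slope k < π → a k = 0

variable {P}

lemma isFill_seg (x : ℝ) : P.IsFill (P.seg x) := by
  refine ⟨fun k => ?_, fun k => ?_⟩
  · induction k using Fin.lastCases with
    | last => rw [seg_last]; exact le_max_left _ _
    | cast k => rw [seg_castSucc]; exact le_min (P.len_pos k).le (le_max_left _ _)
  · rw [seg_castSucc]; exact min_le_left _ _

lemma IsOptimalFill.sum_le {π : ℝ} {a b : Fin (P.m + 1) → ℝ} (ha : P.IsOptimalFill π a)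
    (hb : P.IsFill b) :
    ∑ k, P.slope k * b k - π * ∑ k, b k ≤ ∑ k, P.slope k * a k - π * ∑ k, a k := by
  simp only [Finset.mul_sum, ← Finset.sum_sub_distrib, ← sub_mul]
  refine Finset.sum_le_sum fun k _ => ?_
  rcases lt_trichotomy (P.slope k) π with h | h | h
  · rw [ha.empty k h]
    nlinarith [hb.nonneg k]
  · rw [h]; simp
  · refine mul_le_mul_of_nonneg_left ?_ (sub_nonneg.2 h.le)
    induction k using Fin.lastCases with
    | last => exact absurd ha.last (not_le.2 h)
    | cast k => rw [ha.full k h]; exact hb.le_len k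

lemma exists_isOptimalFill_seg {x : ℝ} (hx : 0 ≤ x) : ∃ π, P.IsOptimalFill π (P.seg x) := by
  obtain ⟨K, hK, hmax⟩ := Finset.exists_max_image (Finset.univ.filter fun k => P.start k ≤ x) id
    ⟨0, by simpa [start_zero] using hx⟩
  simp only [Finset.mem_filter, Finset.mem_univ, true_and, id] at hK hmax
  refine ⟨P.slope K, isFill_seg x, fun k hk => ?_, P.slope_strictAnti.antitone (Fin.le_last K),
    fun k hk => ?_⟩
  · have h1 : k.castSucc < K := P.slope_strictAnti.lt_iff_gt.1 hk
    have h2 := (P.start_mono (Fin.castSucc_lt_iff_succ_le.1 h1)).trans hK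
    rw [start_succ] at h2
    rw [seg_castSucc, min_eq_left]
    exact le_max_of_le_right (by linarith)
  · have h1 : K < k := P.slope_strictAnti.lt_iff_gt.1 hk
    have h2 : x < P.start k := by
      by_contra h
      exact absurd (hmax k (not_lt.1 h)) (not_le.2 h1)
    induction k using Fin.lastCases with
    | last => rw [seg_last, max_eq_left (by linarith)]
    | cast k => rw [seg_castSucc, max_eq_left (by linarith), min_eq_right (P.len_pos k).le]

lemma IsOptimalFill.eval_sum {π : ℝ} {a : Fin (P.m + 1) → ℝ} (ha : P.IsOptimalFill π a) :
    P.eval (∑ k, a k) = ∑ k, P.slope k * a k := by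
  have h0 : 0 ≤ ∑ k, a k := Finset.sum_nonneg fun k _ => ha.nonneg k
  obtain ⟨π', h'⟩ := exists_isOptimalFill_seg (P := P) h0
  have h1 := ha.sum_le (isFill_seg (∑ k, a k))
  have h2 := h'.sum_le ha.toIsFill
  rw [← eval_eq_sum, sum_seg _ h0] at h1 h2
  linarith

/-- An optimal filling maximizes utility minus cost. -/
lemma IsOptimalFill.eval_sub_le {π : ℝ} {a : Fin (P.m + 1) → ℝ} (ha : P.IsOptimalFill π a)
    {x : ℝ} (hx : 0 ≤ x) : P.eval x - π * x ≤ P.eval (∑ k, a k) - π * ∑ k, a k := by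
  have h := ha.sum_le (isFill_seg x)
  rwa [← eval_eq_sum, sum_seg _ hx, ← ha.eval_sum] at h

lemma slope_le_zero (k : Fin (P.m + 1)) : P.slope k ≤ P.slope 0 :=
  P.slope_strictAnti.antitone (Fin.zero_le k)

end PLC

/-! ### Solutions of the market problem -/

namespace Market

variable {A F G : Type*} [Fintype A] [Fintype F] [Fintype G] [DecidableEq G] {M : Market A F G}
  {c : G → ℝ} {x v : (M.Var → ℝ) × ℝ}

/-- Lower bounds on the prices that satisfy the defining inequalities strictly. -/
structure IsStrictBound (M : Market A F G) (c : G → ℝ) : Prop where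
  one_lt : ∀ j, 1 < c j
  slope_mul_lt : ∀ f j k, (M.prod f j).slope k * c (M.out f) < c j

lemma slack_price (x : (M.Var → ℝ) × ℝ) (j : G) : (M.nhadLCP c).slack x (.price j) =
    M.prices c x j + ∑ f with M.out f = j, ∑ j', ∑ k, M.revenue x.1 f j' k -
      ∑ i, ∑ k, x.1 (.spend i j k) - ∑ f, ∑ k, x.1 (.raw f j k) := by
  simp only [AugLCP.slack, nhadLCP, LinearMap.coe_mk, AddHom.coe_mk, lhs, rhs, covering, prices]
  ring

lemma slack_lam (x : (M.Var → ℝ) × ℝ) (i : A) : (M.nhadLCP c).slack x (.lam i) =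
    x.2 + ∑ j, ∑ k, x.1 (.spend i j k) - ∑ j, M.endow i j * M.prices c x j -
      ∑ f, M.share i f * M.firmProfit x.1 f := by
  simp only [AugLCP.slack, nhadLCP, LinearMap.coe_mk, AddHom.coe_mk, lhs, rhs, covering, prices,
    mul_add, Finset.sum_add_distrib]
  ring

lemma slack_spend (x : (M.Var → ℝ) × ℝ) (i : A) (j : G) (k) :
    (M.nhadLCP c).slack x (.spend i j k) =
      M.prices c x j + x.1 (.gam i j k) - (M.util i j).slope k * x.1 (.lam i) := by
  simp only [AugLCP.slack, nhadLCP, LinearMap.coe_mk, AddHom.coe_mk, lhs, rhs, covering, prices]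
  ring

lemma slack_gam (x : (M.Var → ℝ) × ℝ) (i : A) (j : G) (k) :
    (M.nhadLCP c).slack x (.gam i j k) =
      M.utilLen i j k * M.prices c x j - x.1 (.spend i j k) := by
  simp only [AugLCP.slack, nhadLCP, LinearMap.coe_mk, AddHom.coe_mk, lhs, rhs, covering, prices]
  ring

lemma slack_raw (x : (M.Var → ℝ) × ℝ) (f : F) (j : G) (k) :
    (M.nhadLCP c).slack x (.raw f j k) = M.prices c x j + x.1 (.beta f j k) -
      (M.prod f j).slope k * M.prices c x (M.out f) := by
  simp only [AugLCP.slack, nhadLCP, LinearMap.coe_mk, AddHom.coe_mk, lhs, rhs, covering, prices]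
  ring

lemma slack_beta (x : (M.Var → ℝ) × ℝ) (f : F) (j : G) (k) :
    (M.nhadLCP c).slack x (.beta f j k) =
      M.prodLen f j k * M.prices c x j - x.1 (.raw f j k) := by
  simp only [AugLCP.slack, nhadLCP, LinearMap.coe_mk, AddHom.coe_mk, lhs, rhs, covering, prices]
  ring

/-- The linear part of a slack is the slack for the price bounds `0`. -/
lemma lin_eq_slack_zero (v : (M.Var → ℝ) × ℝ) (i : M.Var) :
    (M.nhadLCP c).lin (.inr i) v = (M.nhadLCP 0).slack v i := by
  have h0 : M.rhs 0 i = 0 := by cases i <;> simp [rhs]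
  rw [AugLCP.slack_eq]
  change _ = M.rhs 0 i + _
  rw [h0, zero_add]
  rfl

lemma prices_zero (v : (M.Var → ℝ) × ℝ) (j : G) : M.prices 0 v j = v.1 (.price j) := by
  simp [prices]

lemma sum_with_out (g : F → ℝ) : ∑ j, ∑ f with M.out f = j, g f = ∑ f, g f := by
  simp only [Finset.sum_filter]
  rw [Finset.sum_comm]
  simp

lemma sum_endow_mul (p : G → ℝ) : ∑ i, ∑ j, M.endow i j * p j = ∑ j, p j := by
  rw [Finset.sum_comm]
  simp [← Finset.sum_mul, M.endow_sum]

lemma sum_share_mul (E : F → ℝ) : ∑ i, ∑ f, M.share i f * E f = ∑ f, E f := by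
  rw [Finset.sum_comm]
  simp [← Finset.sum_mul, M.share_sum]

lemma sum_revenue (y : M.Var → ℝ) (f : F) : ∑ j, ∑ k, M.revenue y f j k =
    ∑ j, ∑ k, y (.raw f j k) + M.firmProfit y f := by
  simp only [revenue, firmProfit, Finset.sum_add_distrib]

/-- Walras' law: money is neither created nor lost except by the artificial variable. -/
lemma sum_slack (x : (M.Var → ℝ) × ℝ) :
    ∑ j, (M.nhadLCP c).slack x (.price j) + ∑ i, (M.nhadLCP c).slack x (.lam i) =
      Fintype.card A * x.2 := by
  simp only [slack_price, slack_lam, Finset.sum_add_distrib, Finset.sum_sub_distrib,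
    sum_with_out, sum_endow_mul, sum_share_mul, sum_revenue, Finset.sum_const, Finset.card_univ,
    nsmul_eq_mul]
  rw [Finset.sum_comm (f := fun j i => ∑ k, x.1 (.spend i j k)),
    Finset.sum_comm (f := fun j f => ∑ k, x.1 (.raw f j k))]
  ring

/-! ### Production slopes and truncated lengths -/

lemma finite_slopes : {a | ∃ f j k, a = (M.prod f j).slope k}.Finite := by
  refine (Set.finite_range fun s : (f : F) × (j : G) × Fin ((M.prod f j).m + 1) =>
    (M.prod s.1 s.2.1).slope s.2.2).subset ?_
  rintro a ⟨f, j, k, rfl⟩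
  exact ⟨⟨f, j, k⟩, rfl⟩

lemma slope_le_alphaMax (f : F) (j : G) (k) : (M.prod f j).slope k ≤ M.alphaMax :=
  le_csSup finite_slopes.bddAbove ⟨f, j, k, rfl⟩

lemma alphaMax_nonneg : 0 ≤ M.alphaMax := by
  refine Real.sSup_nonneg ?_
  rintro a ⟨f, j, k, rfl⟩
  exact (M.prod f j).slope_nonneg k

lemma alphaMin_le {f : F} {j : G} {k} (h : (M.prod f j).slope k ≠ 0) :
    M.alphaMin ≤ (M.prod f j).slope k :=
  csInf_le (finite_slopes.subset fun _ h => h.2).bddBelow ⟨h, f, j, k, rfl⟩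

/-- The factor by which the amounts of goods may grow with each step of production. -/
noncomputable def growth (M : Market A F G) : ℝ := Fintype.card G * (M.alphaMax + 1)

lemma bigL_eq : M.bigL = M.growth ^ Fintype.card G := by rw [bigL, growth, mul_pow]

variable [Nonempty G]

lemma one_le_card : (1 : ℝ) ≤ Fintype.card G := by exact_mod_cast Fintype.card_pos

lemma one_le_growth : 1 ≤ M.growth :=
  one_le_mul_of_one_le_of_one_le one_le_card (by linarith [M.alphaMax_nonneg])

lemma bigL_pos : 0 < M.bigL := by
  rw [bigL_eq]; exact pow_pos (zero_lt_one.trans_le one_le_growth) _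

lemma utilLen_pos (i : A) (j : G) (k) : 0 < M.utilLen i j k :=
  PLC.lenTrunc_pos _ (by linarith [M.bigL_pos]) k

lemma prodLen_pos (f : F) (j : G) (k) : 0 < M.prodLen f j k :=
  PLC.lenTrunc_pos _ (div_pos M.bigL_pos (lt_max_of_lt_left one_pos)) k

/-! ### Bounds on the amounts of goods -/

section Solution

variable (hx : (M.nhadLCP c).IsSolution x) (hc : M.IsStrictBound c)

include hx

lemma var_nonneg (v : M.Var) : 0 ≤ x.1 v := hx.1.1 v

lemma slack_nonneg (v : M.Var) : 0 ≤ (M.nhadLCP c).slack x v := hx.1.2.1 v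

lemma slack_eq_zero {v : M.Var} (h : 0 < x.1 v) : (M.nhadLCP c).slack x v = 0 :=
  (mul_eq_zero.1 (hx.2 v)).resolve_left h.ne'

lemma var_eq_zero {v : M.Var} (h : 0 < (M.nhadLCP c).slack x v) : x.1 v = 0 :=
  (mul_eq_zero.1 (hx.2 v)).resolve_right h.ne'

lemma firmProfit_nonneg (f : F) : 0 ≤ M.firmProfit x.1 f :=
  Finset.sum_nonneg fun _ _ => Finset.sum_nonneg fun _ _ =>
    mul_nonneg (M.prodLen_pos _ _ _).le (var_nonneg hx _)

lemma revenue_nonneg (f : F) (j : G) (k) : 0 ≤ M.revenue x.1 f j k :=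
  add_nonneg (var_nonneg hx _) (mul_nonneg (M.prodLen_pos _ _ _).le (var_nonneg hx _))

include hc

lemma bound_le_prices (j : G) : c j ≤ M.prices c x j :=
  le_add_of_nonneg_left (var_nonneg hx _)

lemma prices_pos (j : G) : 0 < M.prices c x j :=
  lt_of_lt_of_le (zero_lt_one.trans (hc.one_lt j)) (bound_le_prices hx hc j)

lemma raw_eq_of_beta_pos {f : F} {j : G} {k} (h : 0 < x.1 (.beta f j k)) :
    x.1 (.raw f j k) = M.prodLen f j k * M.prices c x j := by
  have := slack_eq_zero hx h
  rw [slack_beta] at this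
  linarith

lemma raw_pos_of_beta_pos {f : F} {j : G} {k} (h : 0 < x.1 (.beta f j k)) :
    0 < x.1 (.raw f j k) := by
  rw [raw_eq_of_beta_pos hx hc h]
  exact mul_pos (M.prodLen_pos f j k) (prices_pos hx hc j)

lemma spend_eq_of_gam_pos {i : A} {j : G} {k} (h : 0 < x.1 (.gam i j k)) :
    x.1 (.spend i j k) = M.utilLen i j k * M.prices c x j := by
  have := slack_eq_zero hx h
  rw [slack_gam] at this
  linarith

lemma spend_pos_of_gam_pos {i : A} {j : G} {k} (h : 0 < x.1 (.gam i j k)) :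
    0 < x.1 (.spend i j k) := by
  rw [spend_eq_of_gam_pos hx hc h]
  exact mul_pos (M.utilLen_pos i j k) (prices_pos hx hc j)

omit hc in
lemma slope_mul_of_raw_pos {f : F} {j : G} {k} (h : 0 < x.1 (.raw f j k)) :
    (M.prod f j).slope k * M.prices c x (M.out f) = M.prices c x j + x.1 (.beta f j k) := by
  have := slack_eq_zero hx h
  rw [slack_raw] at this
  linarith

/-- The revenue from a segment is the value of what is produced on it. -/
lemma revenue_mul_price (f : F) (j : G) (k) : M.revenue x.1 f j k * M.prices c x j =
    (M.prod f j).slope k * M.prices c x (M.out f) * x.1 (.raw f j k) := by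
  rcases (var_nonneg hx (.raw f j k)).eq_or_lt with h | h
  · have hb : x.1 (.beta f j k) = 0 := by
      by_contra hb
      have := raw_pos_of_beta_pos hx hc ((var_nonneg hx _).lt_of_ne (Ne.symm hb))
      linarith
    simp [revenue, ← h, hb]
  · rw [slope_mul_of_raw_pos hx h, revenue]
    rcases (var_nonneg hx (.beta f j k)).eq_or_lt with hb | hb
    · rw [← hb]; ring
    · rw [raw_eq_of_beta_pos hx hc hb]; ring

/-- Relative to the lower bounds, the price of a good is smaller than the price of any good which it
is used to produce. -/
lemma ratio_lt_of_raw_pos {f : F} {j : G} {k} (h : 0 < x.1 (.raw f j k)) :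
    M.prices c x j / c j < M.prices c x (M.out f) / c (M.out f) := by
  have hcp : ∀ j, 0 < c j := fun j => zero_lt_one.trans (hc.one_lt j)
  rw [div_lt_div_iff₀ (hcp _) (hcp _)]
  have h1 := slope_mul_of_raw_pos hx h
  have h2 := var_nonneg hx (.beta f j k)
  have h3 := mul_lt_mul_of_pos_right (hc.slope_mul_lt f j k) (prices_pos hx hc (M.out f))
  have h4 := mul_nonneg h2 (hcp (M.out f)).le
  have h5 := congrArg (· * c (M.out f)) h1
  nlinarith

omit [Nonempty G] hx hc in
/-- The total amount of a good that is available: one unit, and what is produced. -/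
noncomputable def supply (M : Market A F G) (c : G → ℝ) (x : (M.Var → ℝ) × ℝ) (j : G) : ℝ :=
  1 + (∑ f with M.out f = j, ∑ j', ∑ k, M.revenue x.1 f j' k) / M.prices c x j

lemma supply_mul_price (j : G) : M.supply c x j * M.prices c x j =
    M.prices c x j + ∑ f with M.out f = j, ∑ j', ∑ k, M.revenue x.1 f j' k := by
  rw [supply, add_mul, one_mul, div_mul_cancel₀ _ (prices_pos hx hc j).ne']

lemma demand_le_supply (j : G) : ∑ i, ∑ k, x.1 (.spend i j k) + ∑ f, ∑ k, x.1 (.raw f j k) ≤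
    M.supply c x j * M.prices c x j := by
  rw [supply_mul_price hx hc]
  have := slack_nonneg hx (.price j)
  rw [slack_price] at this
  linarith

omit hc in
lemma sum_spend_nonneg (j : G) : 0 ≤ ∑ i, ∑ k, x.1 (.spend i j k) :=
  Finset.sum_nonneg fun _ _ => Finset.sum_nonneg fun _ _ => var_nonneg hx _

omit hc in
lemma sum_raw_nonneg (j : G) : 0 ≤ ∑ f, ∑ k, x.1 (.raw f j k) :=
  Finset.sum_nonneg fun _ _ => Finset.sum_nonneg fun _ _ => var_nonneg hx _

/-- The number of goods with a smaller price relative to the lower bounds. -/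
noncomputable def rank (c : G → ℝ) (x : (M.Var → ℝ) × ℝ) (j : G) : ℕ :=
  (Finset.univ.filter fun j' => M.prices c x j' / c j' < M.prices c x j / c j).card

lemma supply_le_sum (j : G) : M.supply c x j ≤ 1 + M.alphaMax *
    ∑ j' with M.prices c x j' / c j' < M.prices c x j / c j, M.supply c x j' := by
  have hp := prices_pos hx hc
  rw [supply, Finset.sum_div]
  have h1 : ∀ f ∈ Finset.univ.filter fun f => M.out f = j,
      (∑ j', ∑ k, M.revenue x.1 f j' k) / M.prices c x j ≤
        M.alphaMax * ∑ j', (∑ k, x.1 (.raw f j' k)) / M.prices c x j' := by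
    intro f hf
    have hf' : M.out f = j := (Finset.mem_filter.1 hf).2
    simp only [Finset.sum_div, Finset.mul_sum]
    refine Finset.sum_le_sum fun j' _ => Finset.sum_le_sum fun k _ => ?_
    have h2 := revenue_mul_price hx hc f j' k
    rw [hf'] at h2
    rw [div_le_iff₀ (hp j), mul_div_assoc', div_mul_eq_mul_div, le_div_iff₀ (hp j'), h2,
      mul_right_comm]
    have h3 := M.slope_le_alphaMax f j' k
    have h4 := mul_nonneg (var_nonneg hx (.raw f j' k)) (hp j).le
    nlinarith
  refine add_le_add_right ((Finset.sum_le_sum h1).trans ?_) 1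
  rw [← Finset.mul_sum, Finset.sum_comm]
  refine mul_le_mul_of_nonneg_left ?_ M.alphaMax_nonneg
  rw [Finset.sum_filter]
  refine Finset.sum_le_sum fun j' _ => ?_
  split_ifs with hr
  · rw [← Finset.sum_div, div_le_iff₀ (hp j')]
    refine le_trans ?_ ((le_add_of_nonneg_left (sum_spend_nonneg hx j')).trans
      (demand_le_supply hx hc j'))
    exact Finset.sum_le_sum_of_subset_of_nonneg (Finset.filter_subset _ _)
      fun _ _ _ => Finset.sum_nonneg fun _ _ => var_nonneg hx _
  · refine (Finset.sum_eq_zero fun f hf => ?_).le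
    have hf' : M.out f = j := (Finset.mem_filter.1 hf).2
    rw [Finset.sum_eq_zero, zero_div]
    intro k _
    by_contra hne
    refine hr ?_
    have := ratio_lt_of_raw_pos hx hc ((var_nonneg hx (.raw f j' k)).lt_of_ne (Ne.symm hne))
    rwa [hf'] at this

/-- The amounts of goods are bounded along the order given by the relative prices, in which
production proceeds upwards. -/
lemma supply_le_pow_rank (j : G) : M.supply c x j ≤ M.growth ^ M.rank c x j := by
  induction hr : M.rank c x j using Nat.strong_induction_on generalizing j with
  | _ r ih =>
    have hB := M.one_le_growth
    have hα := M.alphaMax_nonneg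
    have h1 := supply_le_sum hx hc j
    have h2 : ∀ j' ∈ Finset.univ.filter
        (fun j' => M.prices c x j' / c j' < M.prices c x j / c j),
        M.supply c x j' ≤ M.growth ^ (r - 1) := by
      intro j' hj'
      have hlt : M.rank c x j' < r := by
        rw [← hr]
        refine Finset.card_lt_card ⟨fun g hg => ?_, fun hss => ?_⟩
        · simp only [Finset.mem_filter, Finset.mem_univ, true_and] at hg hj' ⊢
          exact hg.trans hj'
        · have := hss hj'
          simp at this
      exact (ih _ hlt j' rfl).trans (pow_le_pow_right₀ hB (by omega))
    have h3 := Finset.sum_le_card_nsmul _ _ _ h2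
    rw [show (Finset.univ.filter fun j' => M.prices c x j' / c j' < M.prices c x j / c j).card = r
      from hr, nsmul_eq_mul] at h3
    have h4 := h1.trans (add_le_add_right (mul_le_mul_of_nonneg_left h3 hα) 1)
    cases r with
    | zero => simpa using h4
    | succ r =>
      have hle : ((r + 1 : ℕ) : ℝ) ≤ Fintype.card G := by
        rw [← hr]; exact_mod_cast Finset.card_le_univ _
      have hP : 1 ≤ M.growth ^ r := one_le_pow₀ hB
      have hn := one_le_card (G := G)
      rw [Nat.add_sub_cancel] at h4
      refine h4.trans ?_
      rw [pow_succ, growth]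
      rw [growth] at hP
      have h5 : M.alphaMax * (((r + 1 : ℕ) : ℝ) * (Fintype.card G * (M.alphaMax + 1)) ^ r) ≤
          M.alphaMax * (Fintype.card G * (Fintype.card G * (M.alphaMax + 1)) ^ r) := by
        gcongr
      nlinarith

lemma supply_le_pow (j : G) : M.supply c x j ≤ M.growth ^ (Fintype.card G - 1) := by
  refine (supply_le_pow_rank hx hc j).trans (pow_le_pow_right₀ M.one_le_growth
    (Nat.le_sub_one_of_lt ?_))
  refine Finset.card_lt_univ_of_notMem (x := j) ?_
  simp

lemma supply_le_bigL (j : G) : M.supply c x j ≤ M.bigL := by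
  rw [bigL_eq]
  exact (supply_le_pow hx hc j).trans (pow_le_pow_right₀ M.one_le_growth (Nat.sub_le _ _))

lemma supply_lt_bigL (hα : 0 < M.alphaMax) (j : G) : M.supply c x j < M.bigL := by
  rw [bigL_eq]
  refine (supply_le_pow hx hc j).trans_lt (pow_lt_pow_right₀ ?_ ?_)
  · have := one_le_card (G := G)
    rw [growth]; nlinarith
  · exact Nat.sub_lt Fintype.card_pos one_pos

omit hc in
lemma spend_le_sum (i : A) (j : G) (k) : x.1 (.spend i j k) ≤ ∑ i, ∑ k, x.1 (.spend i j k) :=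
  (Finset.single_le_sum (f := fun k => x.1 (.spend i j k)) (fun _ _ => var_nonneg hx _)
    (Finset.mem_univ k)).trans
  (Finset.single_le_sum (f := fun i => ∑ k, x.1 (.spend i j k))
    (fun _ _ => Finset.sum_nonneg fun _ _ => var_nonneg hx _) (Finset.mem_univ i))

omit hc in
lemma raw_le_sum (f : F) (j : G) (k) : x.1 (.raw f j k) ≤ ∑ f, ∑ k, x.1 (.raw f j k) :=
  (Finset.single_le_sum (f := fun k => x.1 (.raw f j k)) (fun _ _ => var_nonneg hx _)
    (Finset.mem_univ k)).trans
  (Finset.single_le_sum (f := fun f => ∑ k, x.1 (.raw f j k))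
    (fun _ _ => Finset.sum_nonneg fun _ _ => var_nonneg hx _) (Finset.mem_univ f))

omit hc in
lemma revenue_le_sum (f : F) (j : G) (k) : M.revenue x.1 f j k ≤
    ∑ f' with M.out f' = M.out f, ∑ j', ∑ k, M.revenue x.1 f' j' k :=
  (Finset.single_le_sum (f := fun k => M.revenue x.1 f j k) (fun _ _ => revenue_nonneg hx _ _ _)
    (Finset.mem_univ k)).trans <|
  (Finset.single_le_sum (f := fun j => ∑ k, M.revenue x.1 f j k)
    (fun _ _ => Finset.sum_nonneg fun _ _ => revenue_nonneg hx _ _ _) (Finset.mem_univ j)).trans <|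
  Finset.single_le_sum (f := fun f' => ∑ j, ∑ k, M.revenue x.1 f' j k)
    (fun _ _ => Finset.sum_nonneg fun _ _ => Finset.sum_nonneg fun _ _ => revenue_nonneg hx _ _ _)
    (Finset.mem_filter.2 ⟨Finset.mem_univ f, rfl⟩)

/-- No agent buys all of a truncated last segment. -/
lemma slack_gam_last_pos (i : A) (j : G) :
    0 < (M.nhadLCP c).slack x (.gam i j (Fin.last _)) := by
  rw [slack_gam, utilLen, PLC.lenTrunc_last]
  have hp := prices_pos hx hc j
  have h1 := spend_le_sum hx i j (Fin.last _)
  have h2 := demand_le_supply hx hc j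
  have h3 := sum_raw_nonneg hx j
  have h4 := mul_le_mul_of_nonneg_right (supply_le_bigL hx hc j) hp.le
  nlinarith

/-- No firm uses all of a truncated last segment of positive slope: it would need more of the raw
good, or produce more, than is possible. -/
lemma slack_beta_last_pos {f : F} {j : G} (hs : 0 < (M.prod f j).slope (Fin.last _)) :
    0 < (M.nhadLCP c).slack x (.beta f j (Fin.last _)) := by
  refine (slack_nonneg hx _).lt_of_ne fun h0 => ?_
  rw [slack_beta] at h0
  have hraw : x.1 (.raw f j (Fin.last _)) = M.prodLen f j (Fin.last _) * M.prices c x j := by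
    linarith
  rw [prodLen, PLC.lenTrunc_last] at hraw
  have hp := prices_pos hx hc j
  have hpo := prices_pos hx hc (M.out f)
  have hα : 0 < M.alphaMax := hs.trans_le (M.slope_le_alphaMax f j _)
  rcases le_total M.alphaMin 1 with h | h
  · rw [max_eq_left h, div_one] at hraw
    have h1 := raw_le_sum hx f j (Fin.last _)
    have h2 := demand_le_supply hx hc j
    have h3 := sum_spend_nonneg hx j
    have h4 := mul_lt_mul_of_pos_right (supply_lt_bigL hx hc hα j) hp
    linarith
  · rw [max_eq_right h] at hraw
    have hmin : 0 < M.alphaMin := zero_lt_one.trans_le h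
    have h1 := revenue_mul_price hx hc f j (Fin.last _)
    rw [hraw, ← mul_assoc] at h1
    have h2 := mul_right_cancel₀ hp.ne' h1
    have h3 : M.prices c x (M.out f) * M.bigL ≤ M.revenue x.1 f j (Fin.last _) := by
      rw [h2, mul_div_assoc', le_div_iff₀ hmin]
      have := mul_le_mul_of_nonneg_right (M.alphaMin_le hs.ne') (mul_pos hpo M.bigL_pos).le
      linarith
    have h4 := revenue_le_sum hx f j (Fin.last _)
    have h5 := supply_mul_price hx hc (M.out f)
    have h6 := mul_le_mul_of_nonneg_right (supply_le_bigL hx hc (M.out f)) hpo.le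
    linarith

end Solution

end Market

/-! ### Solutions with `z = 0` are equilibria -/

namespace Market

variable {A F G : Type*} [Fintype A] [Fintype F] [Fintype G] [DecidableEq G] {M : Market A F G}
  {c : G → ℝ} {x : (M.Var → ℝ) × ℝ} [Nonempty G]

section Solution

variable (hx : (M.nhadLCP c).IsSolution x) (hc : M.IsStrictBound c)

include hx hc

lemma isOptimalFill_raw (f : F) (j : G) :
    (M.prod f j).IsOptimalFill (M.prices c x j / M.prices c x (M.out f))
      fun k => x.1 (.raw f j k) / M.prices c x j := by
  have hp := prices_pos hx hc j
  have hpo := prices_pos hx hc (M.out f)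
  refine ⟨⟨fun k => div_nonneg (var_nonneg hx _) hp.le, fun k => ?_⟩, fun k hk => ?_, ?_,
    fun k hk => ?_⟩
  · have := slack_nonneg hx (.beta f j k.castSucc)
    rw [slack_beta, prodLen, PLC.lenTrunc_castSucc] at this
    rw [div_le_iff₀ hp]
    linarith
  · rw [div_lt_iff₀ hpo] at hk
    have h1 := slack_nonneg hx (.raw f j k.castSucc)
    rw [slack_raw] at h1
    have h2 := raw_eq_of_beta_pos hx hc (f := f) (j := j) (k := k.castSucc) (by linarith)
    rw [prodLen, PLC.lenTrunc_castSucc] at h2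
    rw [h2, mul_div_cancel_right₀ _ hp.ne']
  · rcases ((M.prod f j).slope_nonneg (Fin.last _)).eq_or_lt with h | h
    · rw [← h]; positivity
    · have h1 := var_eq_zero hx (slack_beta_last_pos hx hc h)
      have h2 := slack_nonneg hx (.raw f j (Fin.last _))
      rw [slack_raw, h1] at h2
      rw [le_div_iff₀ hpo]
      linarith
  · rw [lt_div_iff₀ hpo] at hk
    rw [var_eq_zero hx, zero_div]
    rw [slack_raw]
    linarith [var_nonneg hx (.beta f j k)]

lemma isOptimalFill_spend {i : A} (hl : 0 < x.1 (.lam i)) (j : G) :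
    (M.util i j).IsOptimalFill (M.prices c x j / x.1 (.lam i))
      fun k => x.1 (.spend i j k) / M.prices c x j := by
  have hp := prices_pos hx hc j
  refine ⟨⟨fun k => div_nonneg (var_nonneg hx _) hp.le, fun k => ?_⟩, fun k hk => ?_, ?_,
    fun k hk => ?_⟩
  · have := slack_nonneg hx (.gam i j k.castSucc)
    rw [slack_gam, utilLen, PLC.lenTrunc_castSucc] at this
    rw [div_le_iff₀ hp]
    linarith
  · rw [div_lt_iff₀ hl] at hk
    have h1 := slack_nonneg hx (.spend i j k.castSucc)
    rw [slack_spend] at h1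
    have h2 := spend_eq_of_gam_pos hx hc (i := i) (j := j) (k := k.castSucc) (by linarith)
    rw [utilLen, PLC.lenTrunc_castSucc] at h2
    rw [h2, mul_div_cancel_right₀ _ hp.ne']
  · have h1 := var_eq_zero hx (slack_gam_last_pos hx hc i j)
    have h2 := slack_nonneg hx (.spend i j (Fin.last _))
    rw [slack_spend, h1] at h2
    rw [le_div_iff₀ hl]
    linarith
  · rw [lt_div_iff₀ hl] at hk
    rw [var_eq_zero hx, zero_div]
    rw [slack_spend]
    linarith [var_nonneg hx (.gam i j k)]

lemma price_mul_production (f : F) :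
    M.prices c x (M.out f) * M.production f (M.rawMaterials c x f) =
      ∑ j, ∑ k, M.revenue x.1 f j k := by
  rw [production, Finset.mul_sum]
  refine Finset.sum_congr rfl fun j _ => ?_
  have hp := prices_pos hx hc j
  rw [rawMaterials, Finset.sum_div, (isOptimalFill_raw hx hc f j).eval_sum, Finset.mul_sum]
  refine Finset.sum_congr rfl fun k _ => ?_
  rw [eq_comm, ← mul_right_cancel_iff_of_pos hp, revenue_mul_price hx hc]
  field_simp

lemma price_mul_rawMaterials (f : F) (j : G) :
    M.prices c x j * M.rawMaterials c x f j = ∑ k, x.1 (.raw f j k) := by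
  rw [rawMaterials, mul_div_cancel₀ _ (prices_pos hx hc j).ne']

lemma price_mul_bundles (i : A) (j : G) :
    M.prices c x j * M.bundles c x i j = ∑ k, x.1 (.spend i j k) := by
  rw [bundles, mul_div_cancel₀ _ (prices_pos hx hc j).ne']

lemma profit_eq (f : F) :
    M.profit (M.prices c x) f (M.rawMaterials c x f) = M.firmProfit x.1 f := by
  rw [profit, price_mul_production hx hc, sum_revenue]
  simp only [price_mul_rawMaterials hx hc]
  ring

lemma profit_le (f : F) {y : G → ℝ} (hy : ∀ j, 0 ≤ y j) :
    M.profit (M.prices c x) f y ≤ M.profit (M.prices c x) f (M.rawMaterials c x f) := by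
  have hpo := prices_pos hx hc (M.out f)
  simp only [profit, production, Finset.mul_sum, ← Finset.sum_sub_distrib]
  refine Finset.sum_le_sum fun j _ => ?_
  have h := mul_le_mul_of_nonneg_left ((isOptimalFill_raw hx hc f j).eval_sub_le (hy j)) hpo.le
  rw [← Finset.sum_div, ← rawMaterials, mul_sub, mul_sub, ← mul_assoc, ← mul_assoc,
    mul_div_cancel₀ _ hpo.ne'] at h
  exact h

omit hc in
lemma slack_eq_zero_of_z_eq_zero (hz : x.2 = 0) :
    (∀ j, (M.nhadLCP c).slack x (.price j) = 0) ∧ ∀ i, (M.nhadLCP c).slack x (.lam i) = 0 := by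
  have h := sum_slack (c := c) x
  rw [hz, mul_zero] at h
  have h1 := Finset.sum_nonneg fun j (_ : j ∈ Finset.univ) => slack_nonneg hx (.price j)
  have h2 := Finset.sum_nonneg fun i (_ : i ∈ Finset.univ) => slack_nonneg hx (.lam i)
  refine ⟨fun j => ?_, fun i => ?_⟩
  · exact (Finset.sum_eq_zero_iff_of_nonneg fun j _ => slack_nonneg hx (.price j)).1
      (by linarith) j (Finset.mem_univ j)
  · exact (Finset.sum_eq_zero_iff_of_nonneg fun i _ => slack_nonneg hx (.lam i)).1
      (by linarith) i (Finset.mem_univ i)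

/-- A solution with `z = 0` encodes a market equilibrium. -/
theorem isEquilibrium (hz : x.2 = 0) :
    M.IsEquilibrium (M.prices c x) (M.bundles c x) (M.rawMaterials c x) := by
  have hp := prices_pos hx hc
  obtain ⟨hprice, hlam⟩ := slack_eq_zero_of_z_eq_zero hx hz
  have hincome : ∀ i, M.income (M.prices c x) (M.rawMaterials c x) i =
      ∑ j, M.prices c x j * M.bundles c x i j := by
    intro i
    have := hlam i
    rw [slack_lam, hz] at this
    simp only [income, profit_eq hx hc, price_mul_bundles hx hc]
    linarith
  have hb : ∀ i j, 0 ≤ M.bundles c x i j := fun i j =>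
    div_nonneg (Finset.sum_nonneg fun _ _ => var_nonneg hx _) (hp j).le
  refine ⟨fun j => (hp j).le, fun h => ?_, fun f j => ?_, fun f y hy => profit_le hx hc f hy, hb,
    fun i => (hincome i).ge, fun i y hy hcost => ?_, fun j => ?_⟩
  · obtain ⟨j⟩ := ‹Nonempty G›
    exact (hp j).ne' (congrFun h j)
  · exact div_nonneg (Finset.sum_nonneg fun _ _ => var_nonneg hx _) (hp j).le
  · rw [hincome] at hcost
    rcases (var_nonneg hx (.lam i)).eq_or_lt with hl | hl
    · have hX : ∀ j, M.bundles c x i j = 0 := by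
        intro j
        rw [bundles, Finset.sum_eq_zero, zero_div]
        intro k _
        refine var_eq_zero hx ?_
        rw [slack_spend, ← hl]
        linarith [hp j, var_nonneg hx (.gam i j k)]
      have hy0 : ∀ j, y j = 0 := by
        intro j
        simp only [hX, mul_zero, Finset.sum_const_zero] at hcost
        have h1 : ∀ j ∈ Finset.univ, 0 ≤ M.prices c x j * y j := fun j _ =>
          mul_nonneg (hp j).le (hy j)
        have h2 := (Finset.sum_eq_zero_iff_of_nonneg h1).1
          (le_antisymm hcost (Finset.sum_nonneg h1)) j (Finset.mem_univ j)
        exact (mul_eq_zero.1 h2).resolve_left (hp j).ne'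
      simp only [utility, hX, hy0, le_refl]
    · have h1 : ∑ j, ((M.util i j).eval (y j) - M.prices c x j / x.1 (.lam i) * y j) ≤
          ∑ j, ((M.util i j).eval (M.bundles c x i j) -
            M.prices c x j / x.1 (.lam i) * M.bundles c x i j) := by
        refine Finset.sum_le_sum fun j _ => ?_
        have h := (isOptimalFill_spend hx hc hl j).eval_sub_le (hy j)
        rwa [← Finset.sum_div, ← bundles] at h
      have h2 := div_le_div_of_nonneg_right hcost hl.le
      simp only [Finset.sum_div, mul_div_right_comm] at h2
      simp only [Finset.sum_sub_distrib] at h1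
      simp only [utility]
      linarith
  · have h1 := hprice j
    rw [slack_price] at h1
    have h2 : ∑ f with M.out f = j, ∑ j', ∑ k, M.revenue x.1 f j' k =
        M.prices c x j * ∑ f with M.out f = j, M.production f (M.rawMaterials c x f) := by
      rw [Finset.mul_sum]
      refine Finset.sum_congr rfl fun f hf => ?_
      rw [← price_mul_production hx hc, (Finset.mem_filter.1 hf).2]
    rw [M.endow_sum, ← mul_right_inj' (hp j).ne', mul_add, mul_add, Finset.mul_sum, Finset.mul_sum,
      ← h2]
    simp only [price_mul_bundles hx hc, price_mul_rawMaterials hx hc]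
    linarith

end Solution

end Market

/-! ### Rays of solutions -/

namespace Market

variable {A F G : Type*} [Fintype A] [Fintype F] [Fintype G] [DecidableEq G] {M : Market A F G}
  {c : G → ℝ} {x v : (M.Var → ℝ) × ℝ} [Nonempty G]

/-- The direction of a ray of solutions solves the homogeneous problem. -/
lemma isSolution_of_isRay (hv : (M.nhadLCP c).IsRay x v) : (M.nhadLCP 0).IsSolution v := by
  refine ⟨⟨hv.nonneg, fun i => ?_, hv.z_nonneg⟩, fun i => ?_⟩
  · rw [← lin_eq_slack_zero (c := c)]; exact hv.lin_nonneg i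
  · rw [← lin_eq_slack_zero (c := c)]; exact hv.mul_self i

section Homogeneous

variable (hv : (M.nhadLCP 0).IsSolution v)

include hv

lemma spend_eq_zero_of_price {i : A} {j : G} (k) (hj : v.1 (.price j) = 0) :
    v.1 (.spend i j k) = 0 := by
  have := slack_nonneg hv (.gam i j k)
  rw [slack_gam, prices_zero, hj] at this
  linarith [var_nonneg hv (.spend i j k)]

lemma raw_eq_zero_of_price {f : F} {j : G} (k) (hj : v.1 (.price j) = 0) :
    v.1 (.raw f j k) = 0 := by
  have := slack_nonneg hv (.beta f j k)
  rw [slack_beta, prices_zero, hj] at this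
  linarith [var_nonneg hv (.raw f j k)]

lemma spend_eq_zero_of_lam {i : A} (j : G) (k) (hi : v.1 (.lam i) = 0) :
    v.1 (.spend i j k) = 0 := by
  by_contra hne
  have h := slack_eq_zero hv ((var_nonneg hv (.spend i j k)).lt_of_ne (Ne.symm hne))
  rw [slack_spend, prices_zero, hi] at h
  exact hne (spend_eq_zero_of_price hv k
    (by linarith [var_nonneg hv (.price j), var_nonneg hv (.gam i j k)]))

end Homogeneous

section Ray

variable (hx : (M.nhadLCP c).IsSolution x) (hc : M.IsStrictBound c)
  (hv : (M.nhadLCP c).IsRay x v)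

include hv in
lemma var_mul_slack_zero (i : M.Var) : x.1 i * (M.nhadLCP 0).slack v i = 0 := by
  rw [← lin_eq_slack_zero (c := c)]; exact hv.mul_lin i

include hx hc hv

lemma beta_eq_of_beta_pos {f : F} {j : G} {k} (h : 0 < v.1 (.beta f j k)) :
    v.1 (.beta f j k) =
      (M.prod f j).slope k * v.1 (.price (M.out f)) - v.1 (.price j) := by
  have h1 := (mul_eq_zero.1 (hv.mul_slack (.beta f j k))).resolve_left h.ne'
  rw [slack_beta] at h1
  have h2 : 0 < x.1 (.raw f j k) := by
    have := mul_pos (M.prodLen_pos f j k) (prices_pos hx hc j)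
    linarith
  have h3 := (mul_eq_zero.1 (var_mul_slack_zero hv (.raw f j k))).resolve_left h2.ne'
  rw [slack_raw, prices_zero, prices_zero] at h3
  linarith

lemma gam_eq_of_gam_pos {i : A} {j : G} {k} (h : 0 < v.1 (.gam i j k)) :
    v.1 (.gam i j k) = (M.util i j).slope k * v.1 (.lam i) - v.1 (.price j) := by
  have h1 := (mul_eq_zero.1 (hv.mul_slack (.gam i j k))).resolve_left h.ne'
  rw [slack_gam] at h1
  have h2 : 0 < x.1 (.spend i j k) := by
    have := mul_pos (M.utilLen_pos i j k) (prices_pos hx hc j)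
    linarith
  have h3 := (mul_eq_zero.1 (var_mul_slack_zero hv (.spend i j k))).resolve_left h2.ne'
  rw [slack_spend, prices_zero] at h3
  linarith

omit hc hx in
/-- If the marginal spending power of an agent grows, but the price of a good does not, then the
agent buys the good as far as it is of any use. -/
lemma spend_eq_of_lam_pos {i : A} {j : G} {k} (hi : 0 < v.1 (.lam i))
    (hj : v.1 (.price j) = 0) (hu : 0 < (M.util i j).slope k) :
    x.1 (.spend i j k) = M.utilLen i j k * M.prices c x j := by
  have h1 := slack_nonneg (isSolution_of_isRay hv) (.spend i j k)
  rw [slack_spend, prices_zero, hj] at h1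
  have h2 : 0 < v.1 (.gam i j k) := by nlinarith [mul_pos hu hi]
  have h3 := (mul_eq_zero.1 (hv.mul_slack (.gam i j k))).resolve_left h2.ne'
  rw [slack_gam] at h3
  linarith

lemma price_pos_of_nonSatiated_agent {i : A} {j : G} (hi : 0 < v.1 (.lam i))
    (hs : M.NonSatiated (.inl i) j) : 0 < v.1 (.price j) := by
  have hs : 0 < (M.util i j).slope (Fin.last _) := hs
  have h1 := slack_nonneg (isSolution_of_isRay hv) (.spend i j (Fin.last _))
  have h2 := (mul_eq_zero.1 (hv.mul_slack (.gam i j (Fin.last _)))).resolve_right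
    (slack_gam_last_pos hx hc i j).ne'
  rw [slack_spend, prices_zero, h2] at h1
  linarith [mul_pos hs hi]

lemma price_pos_of_nonSatiated_firm {f : F} {j : G} (hf : 0 < v.1 (.price (M.out f)))
    (hs : M.NonSatiated (.inr f) j) : 0 < v.1 (.price j) := by
  have hs : 0 < (M.prod f j).slope (Fin.last _) := hs
  have h1 := slack_nonneg (isSolution_of_isRay hv) (.raw f j (Fin.last _))
  have h2 := (mul_eq_zero.1 (hv.mul_slack (.beta f j (Fin.last _)))).resolve_right
    (slack_beta_last_pos hx hc hs).ne'
  rw [slack_raw, prices_zero, prices_zero, h2] at h1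
  linarith [mul_pos hs hf]

/-- If the marginal spending power of all agents grows, then so do all prices: otherwise, among the
goods with constant price, the one with the smallest price relative to the lower bounds is not
produced, while the demand for it exceeds one unit. -/
lemma price_pos_of_lam_pos (hdemand : M.EnoughDemand) (hl : ∀ i, 0 < v.1 (.lam i)) (j₀ : G) :
    0 < v.1 (.price j₀) := by
  by_contra hj₀
  obtain ⟨j, hj, hmin⟩ := Finset.exists_min_image
    (Finset.univ.filter fun j => ¬ 0 < v.1 (.price j)) (fun j => M.prices c x j / c j)
    ⟨j₀, by simpa using hj₀⟩
  simp only [Finset.mem_filter, Finset.mem_univ, true_and] at hj hmin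
  have hpj := prices_pos hx hc j
  have hj0 : v.1 (.price j) = 0 := le_antisymm (not_lt.1 hj) (hv.nonneg _)
  have hraw : ∀ f, M.out f = j → ∀ j' k, x.1 (.raw f j' k) = 0 := by
    intro f hf j' k
    by_contra hne
    have hpos := (var_nonneg hx (.raw f j' k)).lt_of_ne (Ne.symm hne)
    have h1 := ratio_lt_of_raw_pos hx hc hpos
    rw [hf] at h1
    have h2 : 0 < v.1 (.price j') := by
      by_contra h
      exact absurd (hmin j' h) (not_le.2 h1)
    have h3 := (mul_eq_zero.1 (var_mul_slack_zero hv (.raw f j' k))).resolve_left hne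
    rw [slack_raw, prices_zero, prices_zero, hf, hj0] at h3
    linarith [hv.nonneg (.beta f j' k)]
  have hrev : ∑ f with M.out f = j, ∑ j', ∑ k, M.revenue x.1 f j' k = 0 := by
    refine Finset.sum_eq_zero fun f hf => Finset.sum_eq_zero fun j' _ =>
      Finset.sum_eq_zero fun k _ => ?_
    have h1 := revenue_mul_price hx hc f j' k
    rw [hraw f (Finset.mem_filter.1 hf).2, mul_zero] at h1
    exact (mul_eq_zero.1 h1).resolve_right (prices_pos hx hc j').ne'
  have h1 := slack_nonneg hx (.price j)
  rw [slack_price, hrev] at h1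
  have h2 := sum_raw_nonneg hx j
  have h3 : M.desire j * M.prices c x j ≤ ∑ i, ∑ k, x.1 (.spend i j k) := by
    simp only [desire, Finset.sum_mul]
    refine Finset.sum_le_sum fun i _ => Finset.sum_le_sum fun k _ => ?_
    split_ifs with hu
    · exact (spend_eq_of_lam_pos hv (hl i) hj0 hu).ge
    · rw [zero_mul]; exact var_nonneg hx _
  have h4 := mul_lt_mul_of_pos_right (hdemand j) hpj
  linarith

/-- If no price grows along a ray of solutions, then no variable grows but `z`. -/
lemma fst_eq_zero_of_price (hconn : M.StronglyConnected) (hdemand : M.EnoughDemand)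
    (hp : ∀ j, v.1 (.price j) = 0) : v.1 = 0 := by
  have hv' := isSolution_of_isRay hv
  have hlam : ∀ i, v.1 (.lam i) = 0 := by
    intro i
    by_contra hne
    have hi := (hv.nonneg (.lam i)).lt_of_ne (Ne.symm hne)
    have hall : ∀ i', 0 < v.1 (.lam i') := by
      intro i'
      rcases (hconn i' i).cases_tail with h | ⟨b, -, j, -, hj⟩
      · rwa [← Sum.inl.inj h]
      · exact absurd (hp j) (price_pos_of_nonSatiated_agent hx hc hv hi hj).ne'
    obtain ⟨j⟩ := ‹Nonempty G›
    exact (price_pos_of_lam_pos hx hc hv hdemand hall j).ne' (hp j)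
  funext w
  by_contra hne
  have hpos : 0 < v.1 w := (hv.nonneg w).lt_of_ne (Ne.symm hne)
  cases w with
  | price j => exact hne (hp j)
  | lam i => exact hne (hlam i)
  | spend i j k => exact hne (spend_eq_zero_of_price hv' k (hp j))
  | gam i j k =>
    have := gam_eq_of_gam_pos hx hc hv hpos
    rw [hlam, hp] at this
    linarith
  | raw f j k => exact hne (raw_eq_zero_of_price hv' k (hp j))
  | beta f j k =>
    have := beta_eq_of_beta_pos hx hc hv hpos
    rw [hp, hp] at this
    linarith

lemma slack_price_eq_zero (j : G) : (M.nhadLCP 0).slack v (.price j) = 0 := by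
  have hv' := isSolution_of_isRay hv
  rcases (hv.nonneg (.price j)).eq_or_lt with h | h
  · refine le_antisymm ?_ (slack_nonneg hv' _)
    have hrev : ∑ f with M.out f = j, ∑ j', ∑ k, M.revenue v.1 f j' k = 0 := by
      refine Finset.sum_eq_zero fun f hf => Finset.sum_eq_zero fun j' _ =>
        Finset.sum_eq_zero fun k _ => ?_
      have hf' : M.out f = j := (Finset.mem_filter.1 hf).2
      have h1 : v.1 (.raw f j' k) = 0 := by
        by_contra hne
        have h2 := slack_eq_zero hv' ((hv.nonneg (.raw f j' k)).lt_of_ne (Ne.symm hne))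
        rw [slack_raw, prices_zero, prices_zero, hf', ← h] at h2
        exact hne (raw_eq_zero_of_price hv' k
          (by linarith [hv.nonneg (.price j'), hv.nonneg (.beta f j' k)]))
      have h2 : v.1 (.beta f j' k) = 0 := by
        by_contra hne
        have h3 := (hv.nonneg (.beta f j' k)).lt_of_ne (Ne.symm hne)
        have h4 := beta_eq_of_beta_pos hx hc hv h3
        rw [hf', ← h] at h4
        linarith [hv.nonneg (.price j')]
      rw [revenue, h1, h2, mul_zero, add_zero]
    rw [slack_price, prices_zero, hrev, ← h]
    linarith [sum_spend_nonneg hv' j, sum_raw_nonneg hv' j]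
  · exact slack_eq_zero hv' h

/-- The rate at which the income of an agent grows along a ray of solutions. -/
noncomputable def incomeRate (v : (M.Var → ℝ) × ℝ) (i : A) : ℝ :=
  ∑ j, M.endow i j * v.1 (.price j) + ∑ f, M.share i f * M.firmProfit v.1 f

omit hc hx in
lemma incomeRate_nonneg (i : A) : 0 ≤ incomeRate v i :=
  add_nonneg (Finset.sum_nonneg fun j _ => mul_nonneg (M.endow_nonneg i j) (hv.nonneg _))
    (Finset.sum_nonneg fun f _ => mul_nonneg (M.share_nonneg i f)
      (firmProfit_nonneg (isSolution_of_isRay hv) f))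

omit hc hx hv in
lemma slack_lam_eq (i : A) : (M.nhadLCP 0).slack v (.lam i) =
    v.2 + ∑ j, ∑ k, v.1 (.spend i j k) - incomeRate v i := by
  rw [slack_lam, incomeRate]
  simp only [prices_zero]
  ring

/-- Agents with growing income spend more. -/
lemma lam_pos_of_incomeRate_pos {i : A} (hi : 0 < incomeRate v i) : 0 < v.1 (.lam i) := by
  have hv' := isSolution_of_isRay hv
  have hspend : ∀ i, v.1 (.lam i) = 0 → ∑ j, ∑ k, v.1 (.spend i j k) = 0 := fun i h =>
    Finset.sum_eq_zero fun j _ => Finset.sum_eq_zero fun k _ => spend_eq_zero_of_lam hv' j k h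
  have hle : ∀ i ∈ Finset.univ, (M.nhadLCP 0).slack v (.lam i) ≤ v.2 := by
    intro i _
    rcases (hv.nonneg (.lam i)).eq_or_lt with h | h
    · rw [slack_lam_eq, hspend i h.symm]
      linarith [incomeRate_nonneg hv i]
    · rw [slack_eq_zero hv' h]; exact hv.z_nonneg
  have hsum := sum_slack (c := 0) v
  rw [Finset.sum_eq_zero fun j _ => slack_price_eq_zero hx hc hv j, zero_add] at hsum
  have heq := (Finset.sum_eq_sum_iff_of_le hle).1 (by
    rw [hsum, Finset.sum_const, Finset.card_univ, nsmul_eq_mul]) i (Finset.mem_univ i)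
  rw [slack_lam_eq] at heq
  refine (hv.nonneg _).lt_of_ne fun h => ?_
  rw [hspend i h.symm] at heq
  linarith

/-- If some price grows along a ray of solutions, then all prices grow, and so does the marginal
spending power of all agents: growth of prices is passed on backwards in the graph on the agents and
firms. -/
lemma price_pos_of_price_pos (hconn : M.StronglyConnected) (hdemand : M.EnoughDemand) {j₀ : G}
    (hj₀ : 0 < v.1 (.price j₀)) : (∀ j, 0 < v.1 (.price j)) ∧ ∀ i, 0 < v.1 (.lam i) := by
  let T : A ⊕ F → Prop := Sum.elim (fun i => 0 < incomeRate v i) fun f => 0 < v.1 (.price (M.out f))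
  have hsup : ∀ (a : A ⊕ F) (j : G), M.Supplies a j → 0 < v.1 (.price j) → T a := by
    rintro (i | f) j hs hj
    · have hs : 0 < M.endow i j := hs
      refine add_pos_of_pos_of_nonneg ?_ (Finset.sum_nonneg fun f _ =>
        mul_nonneg (M.share_nonneg i f) (firmProfit_nonneg (isSolution_of_isRay hv) f))
      exact Finset.sum_pos' (fun j _ => mul_nonneg (M.endow_nonneg i j) (hv.nonneg _))
        ⟨j, Finset.mem_univ j, mul_pos hs hj⟩
    · have hs : M.out f = j := hs
      change 0 < v.1 (.price (M.out f))
      rwa [hs]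
  have hsat : ∀ (b : A ⊕ F) (j : G), M.NonSatiated b j → T b → 0 < v.1 (.price j) := by
    rintro (i | f) j hs hb
    · exact price_pos_of_nonSatiated_agent hx hc hv (lam_pos_of_incomeRate_pos hx hc hv hb) hs
    · exact price_pos_of_nonSatiated_firm hx hc hv hb hs
  obtain ⟨i₀, hi₀⟩ : ∃ i, 0 < M.endow i j₀ := by
    by_contra hnone
    push Not at hnone
    have := Finset.sum_nonpos fun i (_ : i ∈ Finset.univ) => hnone i
    rw [M.endow_sum] at this
    linarith
  have hT₀ : T (.inl i₀) := hsup (.inl i₀) j₀ hi₀ hj₀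
  have hT : ∀ i, T (.inl i) := by
    intro i
    have h := hconn i i₀
    generalize Sum.inl i = a at h
    induction h using Relation.ReflTransGen.head_induction_on with
    | refl => exact hT₀
    | head h _ ih =>
      obtain ⟨j, hs, hn⟩ := h
      exact hsup _ j hs (hsat _ j hn ih)
  have hl : ∀ i, 0 < v.1 (.lam i) := fun i => lam_pos_of_incomeRate_pos hx hc hv (hT i)
  exact ⟨price_pos_of_lam_pos hx hc hv hdemand hl, hl⟩

/-- If only `z` grows along a ray of solutions, then it starts at a point with `y = 0`. -/
lemma fst_eq_zero_of_primary (hv1 : v.1 = 0) (hv0 : v ≠ 0) : x.1 = 0 := by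
  have hp := prices_pos hx hc
  have hcp : ∀ j, 0 < c j := fun j => zero_lt_one.trans (hc.one_lt j)
  have hz : 0 < v.2 := hv.z_nonneg.lt_of_ne fun h => hv0 (Prod.ext hv1 h.symm)
  have hlam : ∀ i, x.1 (.lam i) = 0 := by
    intro i
    refine (mul_eq_zero.1 (hv.mul_lin (.lam i))).resolve_right ?_
    rw [AugLCP.lin_inr, hv1, map_zero]
    simpa [nhadLCP, covering] using hz.ne'
  have hspend : ∀ i j k, x.1 (.spend i j k) = 0 := by
    intro i j k
    refine var_eq_zero hx ?_
    rw [slack_spend, hlam]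
    linarith [hp j, var_nonneg hx (.gam i j k)]
  have hprice : ∀ j, x.1 (.price j) = 0 := by
    -- A good whose price is largest relative to the lower bounds is not used by the firms.
    obtain ⟨j₀, -, hmax⟩ := Finset.exists_max_image Finset.univ
      (fun j => M.prices c x j / c j) Finset.univ_nonempty
    have hraw : ∀ f k, x.1 (.raw f j₀ k) = 0 := by
      intro f k
      by_contra hne
      have h1 := ratio_lt_of_raw_pos hx hc ((var_nonneg hx (.raw f j₀ k)).lt_of_ne (Ne.symm hne))
      exact absurd (hmax _ (Finset.mem_univ _)) (not_le.2 h1)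
    have h0 : x.1 (.price j₀) = 0 := by
      refine var_eq_zero hx ?_
      rw [slack_price]
      simp only [hspend, hraw, Finset.sum_const_zero, sub_zero]
      exact add_pos_of_pos_of_nonneg (hp j₀) (Finset.sum_nonneg fun _ _ => Finset.sum_nonneg
        fun _ _ => Finset.sum_nonneg fun _ _ => revenue_nonneg hx _ _ _)
    intro j
    have h1 := hmax j (Finset.mem_univ j)
    rw [show M.prices c x j₀ = c j₀ by simp [prices, h0], div_self (hcp j₀).ne',
      div_le_one (hcp j), prices] at h1
    linarith [var_nonneg hx (.price j)]
  have hraw : ∀ f j k, x.1 (.raw f j k) = 0 := by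
    intro f j k
    by_contra hne
    have h1 := slope_mul_of_raw_pos hx ((var_nonneg hx (.raw f j k)).lt_of_ne (Ne.symm hne))
    simp only [prices, hprice, zero_add] at h1
    linarith [hc.slope_mul_lt f j k, var_nonneg hx (.beta f j k)]
  funext w
  by_contra hne
  have hpos : 0 < x.1 w := (var_nonneg hx w).lt_of_ne (Ne.symm hne)
  cases w with
  | price j => exact hne (hprice j)
  | lam i => exact hne (hlam i)
  | spend i j k => exact hne (hspend i j k)
  | gam i j k => exact (spend_pos_of_gam_pos hx hc hpos).ne' (hspend i j k)
  | raw f j k => exact hne (hraw f j k)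
  | beta f j k => exact (raw_pos_of_beta_pos hx hc hpos).ne' (hraw f j k)

/-- A ray of solutions is the primary ray, or all prices and marginal spending powers grow along
it. -/
theorem ray_cases (hconn : M.StronglyConnected) (hdemand : M.EnoughDemand) (hv0 : v ≠ 0) :
    (x.1 = 0 ∧ v.1 = 0) ∨ ((∀ j, 0 < v.1 (.price j)) ∧ ∀ i, 0 < v.1 (.lam i)) := by
  by_cases hp : ∃ j, 0 < v.1 (.price j)
  · obtain ⟨j, hj⟩ := hp
    exact .inr (price_pos_of_price_pos hx hc hv hconn hdemand hj)
  · push Not at hp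
    have hv1 := fst_eq_zero_of_price hx hc hv hconn hdemand
      fun j => le_antisymm (hp j) (hv.nonneg _)
    exact .inl ⟨fst_eq_zero_of_primary hx hc hv hv1 hv0, hv1⟩

end Ray

end Market

/-! ### Potentials for graphs without expanding cycles -/

section Potential

variable {G : Type*}

/-- The product of the weights along the first `m` edges of a walk. -/
def walkWeight (W : G → G → ℝ) (g : ℕ → G) (m : ℕ) : ℝ := ∏ t ∈ Finset.range m, W (g t) (g (t + 1))

lemma walkWeight_eq_prod_fin (W : G → G → ℝ) (g : ℕ → G) (n : ℕ) (h : g (n + 1) = g 0) :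
    walkWeight W g (n + 1) = ∏ t : Fin (n + 1), W (g t) (g (t + 1 : Fin (n + 1))) := by
  rw [walkWeight, Finset.prod_range]
  refine Finset.prod_congr rfl fun t _ => ?_
  congr 1
  induction t using Fin.lastCases with
  | last => simp [h]
  | cast t => simp

lemma walkWeight_add (W : G → G → ℝ) (g : ℕ → G) (m n : ℕ) :
    walkWeight W g (m + n) = walkWeight W g m * walkWeight W (fun t => g (m + t)) n :=
  Finset.prod_range_add _ _ _

lemma walkWeight_nonneg {W : G → G → ℝ} (hW : ∀ j j', 0 ≤ W j j') (g : ℕ → G) (m : ℕ) :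
    0 ≤ walkWeight W g m := Finset.prod_nonneg fun _ _ => hW _ _

/-- If the weight of short closed walks is at most one, then removing closed walks shows that the
weights of all walks are bounded. -/
lemma walkWeight_le [Fintype G] {W : G → G → ℝ} {B : ℝ} (hW : ∀ j j', 0 ≤ W j j') (hB : 1 ≤ B)
    (hWB : ∀ j j', W j j' ≤ B)
    (hcyc : ∀ g m, 0 < m → m ≤ Fintype.card G → g m = g 0 → walkWeight W g m ≤ 1)
    (g : ℕ → G) (m : ℕ) : walkWeight W g m ≤ B ^ Fintype.card G := by
  induction m using Nat.strong_induction_on generalizing g with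
  | _ m ih =>
    rcases le_or_gt m (Fintype.card G) with hm | hm
    · calc walkWeight W g m ≤ ∏ t ∈ Finset.range m, B :=
            Finset.prod_le_prod (fun _ _ => hW _ _) fun _ _ => hWB _ _
        _ = B ^ m := by simp
        _ ≤ B ^ Fintype.card G := pow_le_pow_right₀ hB hm
    · obtain ⟨s, e, hse, heq⟩ : ∃ s e : Fin (Fintype.card G + 1), s < e ∧ g s = g e := by
        obtain ⟨s, e, hne, heq⟩ := Fintype.exists_ne_map_eq_of_card_lt
          (fun t : Fin (Fintype.card G + 1) => g t) (by simp)
        rcases lt_or_gt_of_ne hne with h | h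
        · exact ⟨s, e, h, heq⟩
        · exact ⟨e, s, h, heq.symm⟩
      obtain ⟨s, hs⟩ := s
      obtain ⟨e, he⟩ := e
      simp only [Fin.mk_lt_mk] at hse heq
      obtain ⟨d, rfl⟩ := Nat.exists_eq_add_of_lt hse
      obtain ⟨r, rfl⟩ := Nat.exists_eq_add_of_le (show s + d + 1 ≤ m by omega)
      -- the walk with the closed walk between the times `s` and `s + d + 1` removed
      let g' : ℕ → G := fun t => if t ≤ s then g t else g (t + (d + 1))
      have h1 : walkWeight W g' s = walkWeight W g s := by
        refine Finset.prod_congr rfl fun t ht => ?_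
        have := Finset.mem_range.1 ht
        simp only [g']
        rw [if_pos (by omega), if_pos (by omega)]
      have h2 : (fun t => g' (s + t)) = fun t => g (s + d + 1 + t) := by
        funext t
        simp only [g']
        split_ifs with h
        · obtain rfl : t = 0 := by omega
          simpa using heq
        · congr 1; omega
      have h3 := ih (s + r) (by omega) g'
      rw [walkWeight_add, h1, h2] at h3
      have h4 := hcyc (fun t => g (s + t)) (d + 1) (by omega) (by omega) (by
        simpa [add_assoc] using heq.symm)
      rw [walkWeight_add, add_assoc, walkWeight_add]
      have h5 := walkWeight_nonneg hW g s
      have h6 := walkWeight_nonneg hW (fun t => g (s + d + 1 + t)) r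
      refine le_trans ?_ h3
      rw [mul_right_comm, add_assoc]
      exact mul_le_of_le_one_right (mul_nonneg h5 (by simpa [add_assoc] using h6)) h4

/-- If the weights on every cycle multiply to less than one, there is a potential that decreases by
more than the weight along each edge: the largest weight of a walk from a vertex, for slightly
increased edge weights. -/
theorem exists_potential [Fintype G] (W : G → G → ℝ) (hW : ∀ j j', 0 ≤ W j j')
    (hcyc : ∀ (n : ℕ) (g : Fin (n + 1) → G), ∏ t, W (g t) (g (t + 1)) < 1) :
    ∃ c : G → ℝ, (∀ j, 1 < c j) ∧ ∀ j j', W j j' * c j' < c j := by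
  obtain ⟨δ, hδ, hδpos⟩ : ∃ δ : ℝ, (∀ s : (n : Fin (Fintype.card G)) × (Fin (n + 1) → G),
      ∏ t, ((1 + δ) * W (s.2 t) (s.2 (t + 1))) < 1) ∧ 0 < δ := by
    have hev : ∀ s : (n : Fin (Fintype.card G)) × (Fin (n + 1) → G), ∀ᶠ δ : ℝ in 𝓝[>] 0,
        ∏ t, ((1 + δ) * W (s.2 t) (s.2 (t + 1))) < 1 := by
      intro s
      have hcont : Continuous fun δ : ℝ => ∏ t, ((1 + δ) * W (s.2 t) (s.2 (t + 1))) := by fun_prop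
      exact nhdsWithin_le_nhds
        ((hcont.tendsto 0).eventually_lt_const (by simpa using hcyc _ s.2))
    exact ((eventually_all.2 hev).and self_mem_nhdsWithin).exists
  set W' : G → G → ℝ := fun j j' => (1 + δ) * W j j' with hW'def
  have hW' : ∀ j j', 0 ≤ W' j j' := fun j j' => mul_nonneg (by linarith) (hW j j')
  obtain ⟨B, hB⟩ := Finite.exists_le fun s : G × G => W' s.1 s.2
  have hbound := walkWeight_le hW' (le_max_right B 1)
    (fun j j' => (hB (j, j')).trans (le_max_left _ _)) (fun g m hm hmn hg => by
      obtain ⟨n, rfl⟩ := Nat.exists_eq_succ_of_ne_zero hm.ne'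
      rw [Nat.succ_eq_add_one, walkWeight_eq_prod_fin _ _ _ hg]
      exact (hδ ⟨⟨n, by omega⟩, fun t => g t⟩).le)
  let S : G → Set ℝ := fun j => {a | ∃ g m, g 0 = j ∧ a = walkWeight W' g m}
  have hbdd : ∀ j, BddAbove (S j) := fun j => ⟨max B 1 ^ Fintype.card G, by
    rintro _ ⟨g, m, -, rfl⟩; exact hbound g m⟩
  have hone : ∀ j, 1 ∈ S j := fun j => ⟨fun _ => j, 0, rfl, by simp [walkWeight]⟩
  have hpos : ∀ j, 1 ≤ sSup (S j) := fun j => le_csSup (hbdd j) (hone j)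
  have hstep : ∀ j j', W' j j' * sSup (S j') ≤ sSup (S j) := by
    intro j j'
    rcases (hW' j j').eq_or_lt with h | h
    · rw [← h, zero_mul]; linarith [hpos j]
    · rw [mul_comm, ← le_div_iff₀ h]
      refine csSup_le ⟨1, hone j'⟩ ?_
      rintro _ ⟨g, m, rfl, rfl⟩
      rw [le_div_iff₀ h]
      refine le_csSup (hbdd j) ⟨fun t => Nat.casesOn t j g, m + 1, rfl, ?_⟩
      rw [walkWeight, walkWeight, Finset.prod_range_succ']
      rfl
  refine ⟨fun j => 2 * sSup (S j), fun j => by linarith [hpos j], fun j j' => ?_⟩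
  rcases (hW j j').eq_or_lt with h | h
  · rw [← h, zero_mul]; linarith [hpos j]
  · have h1 := hstep j j'
    have h2 : W j j' * sSup (S j') < W' j j' * sSup (S j') :=
      mul_lt_mul_of_pos_right (by simp only [hW'def]; nlinarith) (by linarith [hpos j'])
    linarith

end Potential

/-! ### Lower bounds on the prices -/

namespace Market

variable {A F G : Type*} [Fintype A] [Fintype F] [Fintype G] [DecidableEq G] {M : Market A F G}
  {c : G → ℝ}

lemma exists_isStrictBound (hprod : M.NoProductionOutOfNothing) : ∃ c, M.IsStrictBound c := by
  let W : G → G → ℝ := fun j j' => ⨆ f : {f // M.out f = j'}, (M.prod f.1 j).slope 0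
  have hW : ∀ j j', 0 ≤ W j j' := fun j j' =>
    Real.iSup_nonneg fun f => (M.prod f.1 j).slope_nonneg 0
  obtain ⟨c, hc1, hc⟩ := exists_potential W hW fun n g => by
    by_cases h : ∀ t, Nonempty {f // M.out f = g (t + 1)}
    · have : ∀ t, ∃ f : {f // M.out f = g (t + 1)},
          (M.prod f.1 (g t)).slope 0 = W (g t) (g (t + 1)) := fun t =>
        haveI := h t
        exists_eq_ciSup_of_finite
      choose f hf using this
      simp only [← hf]
      exact hprod n g (fun t => (f t).1) fun t => (f t).2
    · push Not at h
      obtain ⟨t, ht⟩ := h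
      rw [Finset.prod_eq_zero (Finset.mem_univ t) (Real.iSup_of_isEmpty _)]
      exact zero_lt_one
  refine ⟨c, hc1, fun f j k => lt_of_le_of_lt ?_ (hc j (M.out f))⟩
  refine mul_le_mul_of_nonneg_right (((M.prod f j).slope_le_zero k).trans ?_)
    (zero_le_one.trans (hc1 _).le)
  exact le_ciSup (f := fun f : {f' // M.out f' = M.out f} => (M.prod f.1 j).slope 0)
    (Set.finite_range _).bddAbove ⟨f, rfl⟩

lemma IsStrictBound.mem_interior (hc : M.IsStrictBound c) : c ∈ interior M.boundPolyhedron := by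
  let U : Set (G → ℝ) := (⋂ j, {c | 1 < c j}) ∩ ⋂ f, ⋂ j, ⋂ k,
    {c | (M.prod f j).slope k * c (M.out f) < c j}
  have hU : IsOpen U := by
    refine (isOpen_iInter_of_finite fun j => ?_).inter (isOpen_iInter_of_finite fun f =>
      isOpen_iInter_of_finite fun j => isOpen_iInter_of_finite fun k => ?_) <;>
      exact isOpen_lt (by fun_prop) (by fun_prop)
  refine interior_maximal (fun b hb => ?_) hU (a := c) ?_
  · simp only [U, Set.mem_inter_iff, Set.mem_iInter, Set.mem_ofPred_eq] at hb
    exact ⟨fun f j k => (hb.2 f j k).le, fun j => (hb.1 j).le⟩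
  · simp only [U, Set.mem_inter_iff, Set.mem_iInter, Set.mem_ofPred_eq]
    exact ⟨hc.one_lt, hc.slope_mul_lt⟩

lemma isStrictBound_of_mem_interior (hprod : M.NoProductionOutOfNothing)
    (hc : c ∈ interior M.boundPolyhedron) : M.IsStrictBound c := by
  have hdown : ∀ j, ∃ t : ℝ, c - t • Pi.single j 1 ∈ M.boundPolyhedron ∧ 0 < t := by
    intro j
    have hcont : Tendsto (fun t : ℝ => c - t • Pi.single j (1 : ℝ)) (𝓝 0) (𝓝 c) := by
      have : Continuous fun t : ℝ => c - t • Pi.single j (1 : ℝ) := by fun_prop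
      simpa using this.tendsto 0
    have hev : ∀ᶠ t : ℝ in 𝓝[>] 0, c - t • Pi.single j (1 : ℝ) ∈ M.boundPolyhedron :=
      nhdsWithin_le_nhds (hcont (mem_interior_iff_mem_nhds.1 hc))
    exact (hev.and self_mem_nhdsWithin).exists
  refine ⟨fun j => ?_, fun f j k => ?_⟩
  · obtain ⟨t, ht, htpos⟩ := hdown j
    have := ht.2 j
    simp only [Pi.sub_apply, Pi.smul_apply, Pi.single_eq_same, smul_eq_mul, mul_one] at this
    linarith
  · by_cases hj : M.out f = j
    · have h1 : (M.prod f j).slope k < 1 := by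
        have := hprod 0 (fun _ => j) (fun _ => f) fun _ => hj
        exact ((M.prod f j).slope_le_zero k).trans_lt (by simpa using this)
      have h2 : 1 ≤ c j := (interior_subset hc).2 j
      rw [hj]
      nlinarith
    · obtain ⟨t, ht, htpos⟩ := hdown j
      have := ht.1 f j k
      simp only [Pi.sub_apply, Pi.smul_apply, Pi.single_eq_same, Pi.single_eq_of_ne hj, smul_eq_mul,
        mul_one, mul_zero, sub_zero] at this
      linarith

/-! ### The algorithm on a market -/

lemma covering_nonneg (w : M.Var) : 0 ≤ M.covering w := by
  cases w <;> simp [covering]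

lemma sum_rhs (c : G → ℝ) : ∑ j, M.rhs c (.price j) + ∑ i, M.rhs c (.lam i) = 0 := by
  simp [rhs, sum_endow_mul]

variable [Nonempty G]

lemma rhs_pos_of_covering_eq_zero (hc : M.IsStrictBound c) {w : M.Var} (hw : M.covering w = 0) :
    0 < M.rhs c w := by
  have hcp : ∀ j, 0 < c j := fun j => zero_lt_one.trans (hc.one_lt j)
  cases w with
  | lam i => simp [covering] at hw
  | price j => exact hcp j
  | spend i j k => exact hcp j
  | gam i j k => exact mul_pos (M.utilLen_pos i j k) (hcp j)
  | raw f j k => exact sub_pos.2 (hc.slope_mul_lt f j k)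
  | beta f j k => exact mul_pos (M.prodLen_pos f j k) (hcp j)

lemma exists_value_pos (hc : M.IsStrictBound c) : ∃ i, 0 < ∑ j, M.endow i j * c j := by
  have hcp : ∀ j, 0 < c j := fun j => zero_lt_one.trans (hc.one_lt j)
  by_contra hnone
  push Not at hnone
  have h1 := Finset.sum_nonpos fun i (_ : i ∈ Finset.univ) => hnone i
  rw [sum_endow_mul] at h1
  exact absurd h1 (not_le.2 (Finset.sum_pos (fun j _ => hcp j) Finset.univ_nonempty))

/-- Walras' law for the problem with right-hand sides `q`. -/
lemma sum_slack_withRhs (q : M.Var → ℝ) (x : (M.Var → ℝ) × ℝ) :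
    ∑ j, ((M.nhadLCP c).withRhs q).slack x (.price j) +
      ∑ i, ((M.nhadLCP c).withRhs q).slack x (.lam i) =
      ∑ j, q (.price j) + ∑ i, q (.lam i) + Fintype.card A * x.2 := by
  simp only [AugLCP.slack_withRhs, lin_eq_slack_zero, Finset.sum_add_distrib]
  linarith [sum_slack (c := 0) x]

/-- All prices and marginal spending powers cannot grow along a ray of solutions starting at a point
at which there is a surplus of money. -/
lemma false_of_growth {q : M.Var → ℝ} {x v : (M.Var → ℝ) × ℝ}
    (hv : ((M.nhadLCP c).withRhs q).IsRay x v)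
    (hpos : 0 < ∑ j, q (.price j) + ∑ i, q (.lam i) + Fintype.card A * x.2)
    (hp : ∀ j, 0 < v.1 (.price j)) (hl : ∀ i, 0 < v.1 (.lam i)) : False := by
  rw [← sum_slack_withRhs (c := c), Finset.sum_eq_zero fun j _ =>
    (mul_eq_zero.1 (hv.mul_slack (.price j))).resolve_left (hp j).ne',
    Finset.sum_eq_zero fun i _ => (mul_eq_zero.1 (hv.mul_slack (.lam i))).resolve_left (hl i).ne',
    add_zero] at hpos
  exact lt_irrefl _ hpos

lemma card_agents_pos (M : Market A F G) : (0 : ℝ) < Fintype.card A := by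
  obtain ⟨j⟩ := ‹Nonempty G›
  have : Nonempty A := by
    by_contra h
    rw [not_nonempty_iff] at h
    simpa using M.endow_sum j
  exact_mod_cast Fintype.card_pos

theorem terminatesWith_isEquilibrium (hconn : M.StronglyConnected) (hdemand : M.EnoughDemand)
    (hc : M.IsStrictBound c) (hL : (M.nhadLCP c).Nondegenerate) :
    (M.nhadLCP c).TerminatesWith (M.initialConfig c)
      (fun x => M.IsEquilibrium (M.prices c x) (M.bundles c x) (M.rawMaterials c x)) := by
  obtain ⟨i₁, hi₁⟩ := exists_value_pos hc
  have : Nonempty A := ⟨i₁⟩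
  have hle : ∀ i, ∑ j, M.endow i j * c j ≤ M.initialZ c := fun i =>
    le_ciSup (Set.finite_range fun i => ∑ j, M.endow i j * c j).bddAbove i
  have hz : 0 < M.initialZ c := hi₁.trans_le (hle i₁)
  obtain ⟨i₀, hi₀⟩ : ∃ i, ∑ j, M.endow i j * c j = M.initialZ c := exists_eq_ciSup_of_finite
  have hslack : ∀ w, (M.nhadLCP c).slack (0, M.initialZ c) w =
      M.rhs c w + M.initialZ c * M.covering w := by
    intro w; simp [AugLCP.slack, nhadLCP, -LinearMap.coe_mk]
  refine (AugLCP.terminatesWith (L := M.nhadLCP c) hL hz (fun w => ?_) covering_nonneg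
    (i₀ := .lam i₀) zero_lt_one ?_ fun x v hx hv hv0 => ?_).mono
    fun x hx => isEquilibrium hx.2.1 hc hx.2.2
  · rw [hslack]
    by_cases hw : M.covering w = 0
    · rw [hw, mul_zero, add_zero]; exact (rhs_pos_of_covering_eq_zero hc hw).le
    · cases w with
      | lam i => simp only [rhs, covering]; linarith [hle i]
      | _ => exact absurd rfl hw
  · rw [hslack]; simp only [rhs, covering]; linarith
  · refine (ray_cases hx.sol hc hv hconn hdemand hv0).resolve_right fun h => ?_
    refine false_of_growth (c := c) (q := M.rhs c) hv ?_ h.1 h.2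
    rw [sum_rhs, zero_add]
    exact mul_pos M.card_agents_pos hx.pos

/-- Equilibria exist even if the problem is degenerate, by perturbing the right-hand sides such that
the total amount of money increases. -/
theorem exists_isEquilibrium (hconn : M.StronglyConnected) (hdemand : M.EnoughDemand)
    (hc : M.IsStrictBound c) : ∃ p X R, M.IsEquilibrium p X R := by
  cases nonempty_fintype M.Var
  obtain ⟨i₁, hi₁⟩ := exists_value_pos hc
  have hA := M.card_agents_pos
  let U : Set (M.Var → ℝ) := {q | 0 < ∑ j, q (.price j) + ∑ i, q (.lam i)}
  have hU : IsOpen U := isOpen_lt continuous_const (by fun_prop)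
  have hcl : (M.nhadLCP c).q ∈ closure U := by
    have hcont : Tendsto (fun t : ℝ => M.rhs c + fun _ => t) (𝓝[>] 0) (𝓝 (M.rhs c)) := by
      have : Continuous fun t : ℝ => M.rhs c + fun _ => t := by fun_prop
      refine Tendsto.mono_left ?_ nhdsWithin_le_nhds
      convert this.tendsto 0 using 2
      funext w
      simp
    refine mem_closure_of_tendsto hcont ?_
    filter_upwards [self_mem_nhdsWithin] with t ht
    have ht : 0 < t := ht
    simp only [U, Set.mem_ofPred_eq, Pi.add_apply, Finset.sum_add_distrib, Finset.sum_const,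
      Finset.card_univ, nsmul_eq_mul]
    have h1 := sum_rhs (M := M) c
    have h2 := mul_pos hA ht
    have h3 : 0 ≤ (Fintype.card G : ℝ) * t := by positivity
    linarith
  obtain ⟨x, hx, hz⟩ := AugLCP.exists_isSolution (L := M.nhadLCP c) covering_nonneg
    (fun w hw => rhs_pos_of_covering_eq_zero hc hw)
    ⟨.lam i₁, zero_lt_one, by change -∑ j, M.endow i₁ j * c j < 0; linarith⟩ hU hcl
    fun p x v x' v' hpU hx hv _ hv' hsol hray hv0 => by
      refine (ray_cases hsol hc hray hconn hdemand hv0).resolve_right fun h => ?_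
      have h1 := eventually_all.2 fun j =>
        (AugLCP.tendsto_fst_apply hv' (.price j)).eventually_const_lt (h.1 j)
      have h2 := eventually_all.2 fun i =>
        (AugLCP.tendsto_fst_apply hv' (.lam i)).eventually_const_lt (h.2 i)
      obtain ⟨n, hn1, hn2⟩ := (h1.and h2).exists
      exact false_of_growth (hv n) (add_pos_of_pos_of_nonneg (hpU n)
        (mul_nonneg hA.le (hx n).pos.le)) hn1 hn2
  exact ⟨_, _, _, isEquilibrium hx hc hz⟩

end Market

theorem mainTheorem2 {A F G : Type*} [Fintype A] [Fintype F] [Fintype G] [DecidableEq G]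
    [Nonempty G] (M : Market A F G) (hconn : M.StronglyConnected)
    (hprod : M.NoProductionOutOfNothing) (hdemand : M.EnoughDemand) :
    (∃ p X R, M.IsEquilibrium p X R) ∧
      (interior M.boundPolyhedron).Nonempty ∧
      ∀ c ∈ interior M.boundPolyhedron, (M.nhadLCP c).Nondegenerate →
        (M.nhadLCP c).TerminatesWith (M.initialConfig c)
          (fun x => M.IsEquilibrium (M.prices c x) (M.bundles c x) (M.rawMaterials c x)) := by
  obtain ⟨c, hc⟩ := Market.exists_isStrictBound hprod
  exact ⟨Market.exists_isEquilibrium hconn hdemand hc, ⟨c, hc.mem_interior⟩, fun c hc hL =>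
    Market.terminatesWith_isEquilibrium hconn hdemand
      (Market.isStrictBound_of_mem_interior hprod hc) hL⟩
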